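/- Let $H = L_2(\mathbb R)$ (complex-valued functions), let $(Q\psi)(q) = q\psi(q)$ and $(P\psi)(q) = -\mathrm i\psi'(q)$, and for $t\in\mathbb R$ put $Q(t) = Q\cos t + P\sin t$. For real $a,b$ the operator $aQ+bP$ (the closure of its restriction to Schwartz functions) is self-adjoint, and $\operatorname{sgn}(aQ+bP)$ is the bounded operator given by its functional calculus, where $\operatorname{sgn} x$ is $1$, $0$, $-1$ for $x>0$, $x=0$, $x<0$. For bounded operators $S,T$ on $H$ put $S\circ T = \tfrac12(ST+TS)$, and let $\operatorname{Si}(x) = \int_0^x \frac{\sin u}{u}\,\mathrm du$. The Wigner function of $\psi\in H$ is \[ W_\psi(q,p) = \frac1{2\pi}\int_{\mathbb R} \psi\Big(q+\frac x2\Big)\overline{\psi\Big(q-\frac x2\Big)}\,\mathrm e^{-\mathrm i p x}\,\mathrm dx . \] Call a bounded measurable function $f:\mathbb R^2\to\mathbb R$ the Weyl transform (Weyl symbol) of a bounded operator $B:H\to H$ if the set of unit vectors $\psi$ with $\iint |W_\psi|\,\mathrm dq\,\mathrm dp<\infty$ is dense in the unit sphere of $H$ and \[ \iint f(q,p)\,W_\psi(q,p)\,\mathrm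 dq\,\mathrm dp = \langle\psi|B|\psi\rangle \] for every $\psi$ in this set. Then: (i) The function $(q,p)\mapsto \frac2\pi\operatorname{Si}(2qp)$ is the Weyl transform of $(\operatorname{sgn} Q)\circ(\operatorname{sgn} P)$. (ii) For all $s,t\in\mathbb R$ with $\sin(t-s)\ne0$, the function \[ (q,p)\mapsto \frac2\pi\operatorname{Si}\Big(\frac{2}{|\sin(t-s)|}(q\cos s+p\sin s)(q\cos t+p\sin t)\Big) \] is the Weyl transform of $(\operatorname{sgn} Q(s))\circ(\operatorname{sgn} Q(t))$. (iii) Let $A = \operatorname{sgn} Q(0)+\operatorname{sgn} Q(2\pi/3)+\operatorname{sgn} Q(4\pi/3)$. Then \[ \tfrac12(A^2-3) = (\operatorname{sgn} Q(0))\circ(\operatorname{sgn} Q(\tfrac{2\pi}3)) + (\operatorname{sgn} Q(0))\circ(\operatorname{sgn} Q(\tfrac{4\pi}3)) + (\operatorname{sgn} Q(\tfrac{2\pi}3))\circ(\operatorname{sgn} Q(\tfrac{4\pi}3)), \] and the Weyl transform of this operator is the function \[ (q,p)\mapsto \frac2\pi\operatorname{Si}\Big(\frac4{\sqrt3}\,q\cdot\frac{-q+p\sqrt3}2\Big)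 + \frac2\pi\operatorname{Si}\Big(\frac4{\sqrt3}\,q\cdot\frac{-q-p\sqrt3}2\Big) + \frac2\pi\operatorname{Si}\Big(\frac4{\sqrt3}\cdot\frac{-q+p\sqrt3}2\cdot\frac{-q-p\sqrt3}2\Big). \] -/

import Mathlib

open MeasureTheory SchwartzMap FourierTransform
open scoped ENNReal

noncomputable section

namespace Oscillator

/-- The Hilbert space `L²(ℝ; ℂ)` of the Schrödinger representation. -/
abbrev StateSpace : Type := Lp ℂ 2 (volume : Measure ℝ)

/-- Multiplication by an essentially bounded function, as a bounded operator on `L²(ℝ)`. -/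
def mulOp (m : ℝ → ℂ) (hm : MemLp m ∞ (volume : Measure ℝ)) : StateSpace →L[ℂ] StateSpace :=
  (ContinuousLinearMap.mul ℂ ℂ).holderL volume ∞ 2 2 (hm.toLp m)

theorem mulOp_coe (m : ℝ → ℂ) (hm : MemLp m ∞ (volume : Measure ℝ)) (ψ : StateSpace) :
    mulOp m hm ψ =ᵐ[volume] fun x => m x * ψ x := by
  have h := (ContinuousLinearMap.mul ℂ ℂ).coeFn_holder (r := 2) (hm.toLp m) ψ
  filter_upwards [h, hm.coeFn_toLp] with x hx hx'
  rw [← hx']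
  exact hx

theorem memLp_top_of_measurable_bound {m : ℝ → ℂ} (hm : Measurable m) (C : ℝ) (hC : ∀ x, ‖m x‖ ≤ C) :
    MemLp m ∞ (volume : Measure ℝ) :=
  MeasureTheory.memLp_top_of_bound hm.aestronglyMeasurable C (Filter.Eventually.of_forall hC)

/-- The operator `aQ + bP` on Schwartz functions, where `Q` is multiplication by the coordinate
and `P = -i d/dx`. See `quadrature_apply`. -/
def quadrature (a b : ℝ) (φ : 𝓢(ℝ, ℂ)) : 𝓢(ℝ, ℂ) :=
  (a : ℂ) • smulLeftCLM ℂ (fun x : ℝ => (x : ℂ)) φ + (b : ℂ) • ((-Complex.I) • derivCLM ℂ ℂ φ)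

theorem quadrature_apply (a b : ℝ) (φ : 𝓢(ℝ, ℂ)) (x : ℝ) :
    quadrature a b φ x = a * (x * φ x) + b * (-Complex.I * deriv φ x) := by
  have h : Function.HasTemperateGrowth (fun x : ℝ => (x : ℂ)) :=
    Function.Complex.hasTemperateGrowth_ofReal
  simp [quadrature, smulLeftCLM_apply_apply h]

/-- The quadratic phase `x ↦ exp(i c x² / 2)`. -/
def chirp (c x : ℝ) : ℂ := Complex.exp (((c * x ^ 2 / 2 : ℝ) : ℂ) * Complex.I)

theorem norm_chirp (c x : ℝ) : ‖chirp c x‖ = 1 := Complex.norm_exp_ofReal_mul_I _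

theorem continuous_chirp (c : ℝ) : Continuous (chirp c) := by
  unfold chirp; fun_prop

theorem chirp_mul_chirp_neg (c x : ℝ) : chirp c x * chirp (-c) x = 1 := by
  unfold chirp
  rw [← Complex.exp_add, ← Complex.exp_zero]
  congr 1
  push_cast
  ring

theorem memLp_chirp (c : ℝ) : MemLp (chirp c) ∞ (volume : Measure ℝ) :=
  memLp_top_of_measurable_bound (continuous_chirp c).measurable 1 fun x => (norm_chirp c x).le

theorem mulOp_chirp_neg (c : ℝ) (ψ : StateSpace) :
    mulOp (chirp c) (memLp_chirp c) (mulOp (chirp (-c)) (memLp_chirp (-c)) ψ) = ψ := by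
  apply Lp.ext
  filter_upwards [mulOp_coe (chirp c) (memLp_chirp c) (mulOp (chirp (-c)) (memLp_chirp (-c)) ψ),
    mulOp_coe (chirp (-c)) (memLp_chirp (-c)) ψ] with x h1 h2
  rw [h1, h2, ← mul_assoc, chirp_mul_chirp_neg, one_mul]

/-- Multiplication by a quadratic phase, as a unitary operator. -/
def chirpUnitary (c : ℝ) : StateSpace ≃ₗᵢ[ℂ] StateSpace where
  toLinearEquiv := LinearEquiv.ofLinearMap
    (mulOp (chirp c) (memLp_chirp c)).toLinearMap
    (mulOp (chirp (-c)) (memLp_chirp (-c))).toLinearMap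
    (LinearMap.ext fun ψ => mulOp_chirp_neg c ψ)
    (LinearMap.ext fun ψ => by simpa using! mulOp_chirp_neg (-c) ψ)
  norm_map' ψ := by
    have h := mulOp_coe (chirp c) (memLp_chirp c) ψ
    change ‖mulOp (chirp c) (memLp_chirp c) ψ‖ = ‖ψ‖
    rw [Lp.norm_def, Lp.norm_def]
    congr 1
    apply eLpNorm_congr_norm_ae
    filter_upwards [h] with x hx
    rw [hx, norm_mul, norm_chirp, one_mul]

/-- A unitary operator that diagonalizes `aQ + bP`: the identity if `b = 0`, and otherwise
multiplication by `exp(i a x² / (2b))` followed by the Fourier transform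
`ψ ↦ ∫ exp(-2πixξ) ψ(x) dx`. -/
def diagonalizer (a b : ℝ) : StateSpace ≃ₗᵢ[ℂ] StateSpace :=
  open Classical in
  if b = 0 then LinearIsometryEquiv.refl ℂ StateSpace
  else (chirpUnitary (a / b)).trans (Lp.fourierTransformₗᵢ ℝ ℂ)

/-- The real function that `aQ + bP` becomes multiplication by after `diagonalizer a b`. -/
def spectralFun (a b x : ℝ) : ℝ :=
  open Classical in
  if b = 0 then a * x else 2 * Real.pi * b * x

theorem measurable_spectralFun (a b : ℝ) : Measurable (spectralFun a b) := by
  unfold spectralFun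
  split_ifs <;> fun_prop

theorem hasTemperateGrowth_expI :
    Function.HasTemperateGrowth (fun x : ℝ => Complex.exp ((x : ℂ) * Complex.I)) := by
  have hd : ∀ x : ℝ, HasDerivAt (fun x : ℝ => Complex.exp ((x : ℂ) * Complex.I))
      (Complex.I * Complex.exp ((x : ℂ) * Complex.I)) x := fun x => by
    have h := (Complex.ofRealCLM.hasDerivAt (x := x)).mul_const Complex.I
    simpa [mul_comm] using! h.cexp
  have hi : ∀ n : ℕ, iteratedDeriv n (fun x : ℝ => Complex.exp ((x : ℂ) * Complex.I))
      = fun x : ℝ => Complex.I ^ n * Complex.exp ((x : ℂ) * Complex.I) := by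
    intro n
    induction n with
    | zero => simp
    | succ n ih =>
      rw [iteratedDeriv_succ, ih]
      funext x
      rw [((hd x).const_mul _).deriv, pow_succ, mul_assoc]
  refine ⟨((Complex.ofRealCLM.contDiff).mul contDiff_const).cexp, fun n => ⟨0, 1, fun x => ?_⟩⟩
  rw [norm_iteratedFDeriv_eq_norm_iteratedDeriv, hi]
  simp [Complex.norm_exp_ofReal_mul_I]

theorem hasTemperateGrowth_chirp (c : ℝ) : Function.HasTemperateGrowth (chirp c) := by
  have h : Function.HasTemperateGrowth (fun x : ℝ => c * x ^ 2 / 2) := by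
    simp only [div_eq_mul_inv]
    fun_prop
  exact hasTemperateGrowth_expI.comp h

theorem hasDerivAt_chirp (c x : ℝ) :
    HasDerivAt (chirp c) (Complex.I * (c * x) * chirp c x) x := by
  have h : HasDerivAt (fun x : ℝ => c * x ^ 2 / 2) (c * x) x := by
    have := (((hasDerivAt_id x).pow 2).const_mul c).div_const 2
    convert! this using 1
    simp; ring
  have h2 := (h.ofReal_comp.mul_const Complex.I).cexp
  convert! h2 using 1
  unfold chirp
  push_cast
  ring

theorem fourier_deriv_schwartz (χ : 𝓢(ℝ, ℂ)) (ξ : ℝ) :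
    𝓕 (derivCLM ℂ ℂ χ) ξ = 2 * Real.pi * Complex.I * ξ * 𝓕 χ ξ := by
  rw [fourier_coe, fourier_coe]
  have h := Real.fourier_deriv (f := χ) χ.integrable χ.differentiable
    (derivCLM ℂ ℂ χ).integrable
  have hc : (derivCLM ℂ ℂ χ : ℝ → ℂ) = deriv χ := rfl
  rw [hc, h]
  simp

/-- `diagonalizer a b` turns `aQ + bP` into multiplication by `spectralFun a b`. -/
theorem diagonalizer_quadrature (a b : ℝ) (φ : 𝓢(ℝ, ℂ)) :
    diagonalizer a b ((quadrature a b φ).toLp 2) =ᵐ[volume]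
      fun x => (spectralFun a b x : ℂ) * diagonalizer a b (φ.toLp 2) x := by
  by_cases hb : b = 0
  · subst hb
    simp only [diagonalizer, spectralFun, if_true, LinearIsometryEquiv.coe_refl, id]
    filter_upwards [(quadrature a 0 φ).coeFn_toLp 2 volume, φ.coeFn_toLp 2 volume] with x h1 h2
    rw [h1, h2, quadrature_apply]
    push_cast
    ring
  · have key : ∀ χ : 𝓢(ℝ, ℂ), diagonalizer a b (χ.toLp 2)
        = (𝓕 (smulLeftCLM ℂ (chirp (a / b)) χ)).toLp 2 := by
      intro χ
      rw [← SchwartzMap.toLp_fourier_eq]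
      simp only [diagonalizer, if_neg hb, LinearIsometryEquiv.trans_apply]
      change Lp.fourierTransformₗᵢ ℝ ℂ _ = Lp.fourierTransformₗᵢ ℝ ℂ _
      congr 1
      apply Lp.ext
      filter_upwards [mulOp_coe (chirp (a / b)) (memLp_chirp (a / b)) (χ.toLp 2),
        χ.coeFn_toLp 2 volume,
        (smulLeftCLM ℂ (chirp (a / b)) χ).coeFn_toLp 2 volume] with x h1 h2 h3
      rw [h3, smulLeftCLM_apply_apply (hasTemperateGrowth_chirp _), smul_eq_mul, ← h2]
      exact h1
    have hq : smulLeftCLM ℂ (chirp (a / b)) (quadrature a b φ)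
        = (-Complex.I * b) • derivCLM ℂ ℂ (smulLeftCLM ℂ (chirp (a / b)) φ) := by
      ext x
      have hf : (smulLeftCLM ℂ (chirp (a / b)) φ : ℝ → ℂ) = fun y => chirp (a / b) y * φ y := by
        funext y
        rw [smulLeftCLM_apply_apply (hasTemperateGrowth_chirp _), smul_eq_mul]
      have hd := ((hasDerivAt_chirp (a / b) x).mul (φ.hasDerivAt x)).deriv
      rw [smulLeftCLM_apply_apply (hasTemperateGrowth_chirp _), smul_eq_mul, quadrature_apply,
        _root_.smul_apply, derivCLM_apply, hf, smul_eq_mul]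
      erw [hd]
      have hb' : (b : ℂ) ≠ 0 := by exact_mod_cast hb
      push_cast
      field_simp
      ring_nf
      simp only [Complex.I_sq]
      ring
    rw [key, key, hq]
    filter_upwards [(𝓕 ((-Complex.I * b) • derivCLM ℂ ℂ
        (smulLeftCLM ℂ (chirp (a / b)) φ))).coeFn_toLp 2 volume,
      (𝓕 (smulLeftCLM ℂ (chirp (a / b)) φ)).coeFn_toLp 2 volume] with x h1 h2
    rw [h1, h2, FourierTransform.fourier_smul, _root_.smul_apply, fourier_deriv_schwartz]
    simp only [spectralFun, if_neg hb, smul_eq_mul]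
    push_cast
    ring_nf
    simp only [Complex.I_sq]
    ring

theorem memLp_sign_spectralFun (a b : ℝ) :
    MemLp (fun x => (Real.sign (spectralFun a b x) : ℂ)) ∞ (volume : Measure ℝ) := by
  refine memLp_top_of_measurable_bound ?_ 1 fun x => ?_
  · have hs : Measurable Real.sign := by
      unfold Real.sign
      exact Measurable.ite measurableSet_Iio measurable_const
        (Measurable.ite measurableSet_Ioi measurable_const measurable_const)
    exact Complex.measurable_ofReal.comp (hs.comp (measurable_spectralFun a b))
  · rcases Real.sign_apply_eq (spectralFun a b x) with h | h | h <;> simp [h]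

/-- The bounded operator `sgn(aQ + bP)`, by the functional calculus of the self-adjoint operator
`aQ + bP` (the closure of `quadrature a b`, which is essentially self-adjoint): by
`diagonalizer_quadrature`, `aQ + bP` is unitarily equivalent to multiplication by
`spectralFun a b`, and `sgn(aQ + bP)` corresponds to multiplication by the sign of that function. -/
def sgnQuadrature (a b : ℝ) : StateSpace →L[ℂ] StateSpace :=
  ((diagonalizer a b).symm.toContinuousLinearEquiv : StateSpace →L[ℂ] StateSpace) ∘L
    mulOp (fun x => (Real.sign (spectralFun a b x) : ℂ)) (memLp_sign_spectralFun a b) ∘L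
    ((diagonalizer a b).toContinuousLinearEquiv : StateSpace →L[ℂ] StateSpace)

/-- `sgn Q`. -/
def sgnQ : StateSpace →L[ℂ] StateSpace := sgnQuadrature 1 0

/-- `sgn P`. -/
def sgnP : StateSpace →L[ℂ] StateSpace := sgnQuadrature 0 1

/-- `sgn Q(t)`, where `Q(t) = Q cos t + P sin t`. -/
def sgnQt (t : ℝ) : StateSpace →L[ℂ] StateSpace := sgnQuadrature (Real.cos t) (Real.sin t)

/-- `A = sgn Q(0) + sgn Q(2π/3) + sgn Q(4π/3)`. -/
def opA : StateSpace →L[ℂ] StateSpace :=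
  sgnQt 0 + sgnQt (2 * Real.pi / 3) + sgnQt (4 * Real.pi / 3)

/-- The symmetrized product `S ∘ T = (ST + TS) / 2`. -/
def symProd (S T : StateSpace →L[ℂ] StateSpace) : StateSpace →L[ℂ] StateSpace :=
  (1 / 2 : ℂ) • (S * T + T * S)

/-- The sine integral. -/
def Si (x : ℝ) : ℝ := ∫ u in (0 : ℝ)..x, Real.sin u / u

/-- The Wigner function
`W_ψ(q, p) = (2π)⁻¹ ∫ ψ(q + x/2) conj(ψ(q - x/2)) exp(-ipx) dx` at `z = (q, p)`. -/
def wigner (ψ : StateSpace) (z : ℝ × ℝ) : ℂ :=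
  (1 / (2 * Real.pi) : ℂ) * ∫ x : ℝ, ψ (z.1 + x / 2) * (starRingEnd ℂ) (ψ (z.1 - x / 2)) *
    Complex.exp (-Complex.I * (z.2 * x : ℝ))

/-- The state vectors (unit vectors) whose Wigner function is integrable. -/
def wignerIntegrableStates : Set StateSpace :=
  {ψ | ‖ψ‖ = 1 ∧ Integrable (wigner ψ) (volume : Measure (ℝ × ℝ))}

/-- A bounded measurable function `f` is the Weyl transform (Weyl symbol) of the bounded operator
`B`: the states with integrable Wigner function are dense among all states, and
`∬ f W_ψ dq dp = ⟨ψ | B | ψ⟩` for each of them. -/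
structure IsWeylTransform (f : ℝ × ℝ → ℝ) (B : StateSpace →L[ℂ] StateSpace) : Prop where
  measurable : Measurable f
  bounded : ∃ C : ℝ, ∀ z, |f z| ≤ C
  dense : Metric.sphere (0 : StateSpace) 1 ⊆ closure wignerIntegrableStates
  integral_eq : ∀ ψ ∈ wignerIntegrableStates,
    ∫ z : ℝ × ℝ, (f z : ℂ) * wigner ψ z = inner ℂ ψ (B ψ)

end Oscillator

end

noncomputable section

namespace Oscillator

open Filter Topology Set ComplexConjugate

/-! The sign is a Dirichlet integral: `sgn λ = (2/π) ∫₀^∞ sin(yλ)/y dy`, whose truncations are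
bounded uniformly in `λ`. This reduces sign operators to sine operators, hence to Weyl operators
`exp(i(aQ + bP))`, whose symbols are the plane waves `exp(i(aq + bp))`
(`integral_planeWave_mul_wigner`).

Write `α = aq + bp`, `β = a'q + b'p`, `σ = ab' - a'b`. By the Weyl relations (`weylOp_comp`) the two
orderings of a product carry conjugate phases, so the symmetrized product of `sin(x(aQ + bP))` and
`sin(y(a'Q + b'P))` has symbol `sin(xα) sin(yβ) cos(xyσ/2)` (`inner_sinOp_sinOp`). Integrating
against `dy/y` replaces `2 sin(yβ) cos(xyσ/2)` by `(π/2)(sgn(β + xσ/2) + sgn(β - xσ/2))`. Almost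
everywhere in `x > 0`, the sum of signs is `2 sgn β` for `x < 2|β|/|σ|` and `0` beyond. Integrating
next against `dx/x` therefore stops at a finite point and gives `2 sgn β · Si(2|β|α/|σ|) = 2
Si(2αβ/|σ|)`, since `Si` is odd.

Both integrations are limits of truncated ones. On the operator side they converge by dominated
convergence in the spectral variable, on the phase-space side by dominated convergence against the
integrable Wigner function (`tendsto_truncIntegral_pairing` serves both); uniqueness of limits
equates the results.

Density of the admissible states comes from normalized Schwartz functions, whose Wigner functions
decay quadratically in `q` and `p`. The formula for `A` follows by expanding the square, because
each `sgn Q(t)` squares to the identity. -/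

/-! ### The sine integral: continuity, oddness, boundedness, limit at infinity. -/

/-- At `u = 0` the quotient is `0` by the division convention while `sinc` is `1`; passing to the
continuous function changes no integral. -/
theorem sin_div_ae_eq_sinc : (fun u : ℝ => Real.sin u / u) =ᵐ[volume] Real.sinc := by
  filter_upwards [compl_mem_ae_iff.mpr (measure_singleton (0 : ℝ))] with u hu
  rw [Real.sinc_of_ne_zero hu]

theorem Si_eq_integral_sinc (x : ℝ) : Si x = ∫ u in (0 : ℝ)..x, Real.sinc u := by
  unfold Si
  exact intervalIntegral.integral_congr_ae
    (sin_div_ae_eq_sinc.mono fun u hu _ => hu)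

theorem continuous_Si : Continuous Si := by
  have : Si = fun x => ∫ u in (0 : ℝ)..x, Real.sinc u := funext Si_eq_integral_sinc
  rw [this]
  exact intervalIntegral.continuous_primitive
    (fun a b => Real.continuous_sinc.intervalIntegrable a b) 0

@[simp] theorem Si_zero : Si 0 = 0 := by simp [Si]

theorem Si_neg (x : ℝ) : Si (-x) = -Si x := by
  rw [Si_eq_integral_sinc, Si_eq_integral_sinc]
  have h := intervalIntegral.integral_comp_neg (a := 0) (b := x) Real.sinc
  simp only [Real.sinc_neg, neg_zero] at h
  rw [intervalIntegral.integral_symm, ← h]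

theorem sin_mul_div_ae_eq (l : ℝ) :
    (fun u : ℝ => Real.sin (u * l) / u) =ᵐ[volume] fun u => l * Real.sinc (u * l) := by
  filter_upwards [compl_mem_ae_iff.mpr (measure_singleton (0 : ℝ))] with u hu
  rcases eq_or_ne l 0 with rfl | hl
  · simp
  · have hu : u ≠ 0 := hu
    rw [Real.sinc_of_ne_zero (mul_ne_zero hu hl)]
    field_simp

theorem intervalIntegrable_sin_mul_div (l a b : ℝ) :
    IntervalIntegrable (fun u : ℝ => Real.sin (u * l) / u) volume a b := by
  have h : IntervalIntegrable (fun u => l * Real.sinc (u * l)) volume a b :=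
    (continuous_const.mul (Real.continuous_sinc.comp
      (continuous_id.mul continuous_const))).intervalIntegrable a b
  exact h.congr_ae (ae_restrict_of_ae (sin_mul_div_ae_eq l).symm)

theorem integral_zero_sin_mul_div (l R : ℝ) :
    ∫ u in (0 : ℝ)..R, Real.sin (u * l) / u = Si (R * l) := by
  rw [intervalIntegral.integral_congr_ae ((sin_mul_div_ae_eq l).mono fun u hu _ => hu),
    intervalIntegral.integral_const_mul, intervalIntegral.mul_integral_comp_mul_right,
    zero_mul, Si_eq_integral_sinc]

theorem integral_sin_mul_div (l a b : ℝ) :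
    ∫ u in a..b, Real.sin (u * l) / u = Si (b * l) - Si (a * l) := by
  rw [← integral_zero_sin_mul_div, ← integral_zero_sin_mul_div,
    intervalIntegral.integral_interval_sub_left] <;>
  exact intervalIntegrable_sin_mul_div _ _ _

theorem integral_exp_neg_mul_sin (t x : ℝ) :
    ∫ u in (0 : ℝ)..x, Real.exp (-(t * u)) * Real.sin u =
      1 / (1 + t ^ 2) - Real.exp (-(t * x)) * (Real.cos x + t * Real.sin x) / (1 + t ^ 2) := by
  have ht : 1 + t ^ 2 ≠ 0 := by positivity
  have hd : ∀ u : ℝ, HasDerivAt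
      (fun u => -(Real.exp (-(t * u)) * (Real.cos u + t * Real.sin u)) / (1 + t ^ 2))
      (Real.exp (-(t * u)) * Real.sin u) u := fun u => by
    have h1 : HasDerivAt (fun u => Real.exp (-(t * u))) (Real.exp (-(t * u)) * -(t * 1)) u :=
      (((hasDerivAt_id u).const_mul t).neg).exp
    have h2 := (Real.hasDerivAt_cos u).add ((Real.hasDerivAt_sin u).const_mul t)
    have h3 := ((h1.mul h2).neg).div_const (1 + t ^ 2)
    refine h3.congr_deriv ?_
    simp only [Pi.add_apply]
    field_simp
    ring
  rw [intervalIntegral.integral_eq_sub_of_hasDerivAt (fun u _ => hd u)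
    ((by fun_prop : Continuous fun u => Real.exp (-(t * u)) * Real.sin u).intervalIntegrable _ _)]
  simp
  ring

theorem integrableOn_exp_neg_mul {u : ℝ} (hu : 0 < u) :
    IntegrableOn (fun t : ℝ => Real.exp (-(t * u))) (Ioi 0) := by
  have h := integrableOn_exp_mul_Ioi (a := -u) (by linarith) 0
  refine h.congr_fun (fun t _ => ?_) measurableSet_Ioi
  simp only; congr 1; ring

theorem integral_exp_neg_mul_Ioi {u : ℝ} (hu : 0 < u) :
    ∫ t in Ioi (0 : ℝ), Real.exp (-(t * u)) = 1 / u := by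
  have h := integral_exp_mul_Ioi (a := -u) (by linarith) 0
  simp only [mul_zero, Real.exp_zero] at h
  rw [show (1 / u : ℝ) = -1 / -u by rw [neg_div_neg_eq], ← h]
  congr 1; ext t; congr 1; ring

/-- Insert `1/u = ∫₀^∞ exp(-tu) dt` and exchange the integrals; Fubini applies because the inner
integral of the absolute value is `|sinc u|`, integrable on `(0, x]`. -/
theorem Si_eq_integral_Ioi {x : ℝ} (hx : 0 < x) :
    Si x = ∫ t in Ioi (0 : ℝ), (1 / (1 + t ^ 2) -
      Real.exp (-(t * x)) * (Real.cos x + t * Real.sin x) / (1 + t ^ 2)) := by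
  have h1 : Si x = ∫ u in Ioc 0 x, ∫ t in Ioi (0 : ℝ), Real.exp (-(t * u)) * Real.sin u := by
    rw [Si, intervalIntegral.integral_of_le hx.le]
    refine setIntegral_congr_fun measurableSet_Ioc fun u hu => ?_
    rw [integral_mul_const, integral_exp_neg_mul_Ioi hu.1]
    ring
  rw [h1, integral_integral_swap]
  · refine setIntegral_congr_fun measurableSet_Ioi fun t _ => ?_
    rw [← intervalIntegral.integral_of_le hx.le, integral_exp_neg_mul_sin]
  · rw [integrable_prod_iff (by
      exact (by fun_prop : Continuous (Function.uncurry fun u t : ℝ =>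
        Real.exp (-(t * u)) * Real.sin u)).aestronglyMeasurable)]
    refine ⟨?_, ?_⟩
    · filter_upwards [ae_restrict_mem measurableSet_Ioc] with u hu
      exact (integrableOn_exp_neg_mul hu.1).mul_const (Real.sin u)
    · have hb : IntegrableOn (fun u : ℝ => |Real.sinc u|) (Ioc 0 x) :=
        (Real.continuous_sinc.abs).integrableOn_Ioc
      refine hb.congr_fun (fun u hu => ?_) measurableSet_Ioc
      simp only [Function.uncurry, norm_mul, Real.norm_eq_abs, Real.abs_exp]
      rw [integral_mul_const, integral_exp_neg_mul_Ioi hu.1, Real.sinc_of_ne_zero hu.1.ne',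
        abs_div, abs_of_pos hu.1]
      ring

theorem abs_exp_remainder_le {x : ℝ} (t : ℝ) :
    ‖Real.exp (-(t * x)) * (Real.cos x + t * Real.sin x) / (1 + t ^ 2)‖ ≤
      2 * Real.exp (-(t * x)) := by
  have ht : 0 < 1 + t ^ 2 := by positivity
  rw [norm_div, norm_mul, Real.norm_eq_abs, Real.norm_eq_abs, Real.norm_eq_abs, Real.abs_exp,
    abs_of_pos ht, div_le_iff₀ ht]
  -- The constant `2` comes from `1 + |t| ≤ 2(1 + t²)`.
  have h : |Real.cos x + t * Real.sin x| ≤ 2 * (1 + t ^ 2) := by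
    have h1 := abs_add_le (Real.cos x) (t * Real.sin x)
    rw [abs_mul] at h1
    have h2 := Real.abs_cos_le_one x
    have h3 := Real.abs_sin_le_one x
    have h4 : |t| * |Real.sin x| ≤ |t| := mul_le_of_le_one_right (abs_nonneg t) h3
    nlinarith [sq_abs t, sq_nonneg (|t| - 1)]
  nlinarith [Real.exp_pos (-(t * x))]

/-- The main term `∫₀^∞ dt/(1 + t²)` is `π/2`; the remainder is dominated by `2 exp(-tx)`, whose
integral is `2/x`. -/
theorem abs_Si_sub_le {x : ℝ} (hx : 0 < x) : |Si x - Real.pi / 2| ≤ 2 / x := by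
  have hi1 : IntegrableOn (fun t : ℝ => 1 / (1 + t ^ 2)) (Ioi 0) := by
    simpa using integrable_inv_one_add_sq.integrableOn (s := Ioi (0 : ℝ))
  have hi2 : IntegrableOn (fun t : ℝ =>
      Real.exp (-(t * x)) * (Real.cos x + t * Real.sin x) / (1 + t ^ 2)) (Ioi 0) := by
    refine ((integrableOn_exp_neg_mul hx).const_mul 2).mono' ?_
      (Eventually.of_forall fun t => abs_exp_remainder_le t)
    exact (by fun_prop : Measurable fun t : ℝ =>
      Real.exp (-(t * x)) * (Real.cos x + t * Real.sin x) / (1 + t ^ 2)).aestronglyMeasurable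
  have h1 : ∫ t in Ioi (0 : ℝ), 1 / (1 + t ^ 2) = Real.pi / 2 := by
    simp [integral_Ioi_inv_one_add_sq]
  rw [Si_eq_integral_Ioi hx, integral_sub hi1 hi2, h1, sub_sub_cancel_left, abs_neg]
  refine (norm_integral_le_of_norm_le ((integrableOn_exp_neg_mul hx).const_mul 2)
    (Eventually.of_forall fun t => abs_exp_remainder_le t)).trans ?_
  rw [integral_const_mul, integral_exp_neg_mul_Ioi hx]
  exact le_of_eq (by ring)

theorem tendsto_Si_atTop : Tendsto Si atTop (𝓝 (Real.pi / 2)) := by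
  rw [tendsto_iff_dist_tendsto_zero]
  refine squeeze_zero' (Eventually.of_forall fun _ => dist_nonneg)
    ((eventually_gt_atTop 0).mono fun x hx => abs_Si_sub_le hx)
    (tendsto_const_nhds.div_atTop tendsto_id)

/-- Compactness handles `[0, 1]`, the rate `2/x` handles `[1, ∞)`, and oddness the negative axis. -/
theorem exists_abs_Si_le : ∃ C : ℝ, ∀ x, |Si x| ≤ C := by
  obtain ⟨C, hC⟩ := (isCompact_Icc (a := (0 : ℝ)) (b := 1)).exists_bound_of_continuousOn
    continuous_Si.continuousOn
  have hpos : ∀ x : ℝ, 0 ≤ x → |Si x| ≤ max C (Real.pi / 2 + 2) := fun x hx => by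
    rcases le_total x 1 with h | h
    · exact (hC x ⟨hx, h⟩).trans (le_max_left _ _)
    · refine le_trans ?_ (le_max_right _ _)
      have h1 := abs_Si_sub_le (lt_of_lt_of_le one_pos h)
      have h2 : 2 / x ≤ 2 := div_le_self (by norm_num) h
      have h3 := abs_sub_abs_le_abs_sub (Si x) (Real.pi / 2)
      rw [abs_of_pos (by positivity : 0 < Real.pi / 2)] at h3
      linarith
  refine ⟨max C (Real.pi / 2 + 2), fun x => ?_⟩
  rcases le_total 0 x with h | h
  · exact hpos x h
  · rw [← neg_neg x, Si_neg, abs_neg]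
    exact hpos _ (by linarith)

theorem tendsto_Si_mul_atTop (l : ℝ) :
    Tendsto (fun R : ℝ => Si (R * l)) atTop (𝓝 (Real.pi / 2 * Real.sign l)) := by
  rcases lt_trichotomy l 0 with h | rfl | h
  · rw [Real.sign_of_neg h]
    have : (fun R : ℝ => Si (R * l)) = fun R => -Si (R * -l) := by
      funext R; rw [mul_neg, Si_neg, neg_neg]
    rw [this, mul_neg, mul_one]
    exact (tendsto_Si_atTop.comp (tendsto_id.atTop_mul_const (by linarith))).neg
  · simp
  · rw [Real.sign_of_pos h, mul_one]
    exact tendsto_Si_atTop.comp (tendsto_id.atTop_mul_const h)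

/-! ### Truncated Dirichlet integrals and passage to the limit under a pairing. -/

/-- The integral over `y ∈ (1/(n+1), n+1)`, which exhausts `(0, ∞)`. -/
def truncIntegral {E : Type*} [NormedAddCommGroup E] [NormedSpace ℝ E] (n : ℕ) (g : ℝ → E) : E :=
  ∫ y in (1 / ((n : ℝ) + 1))..((n : ℝ) + 1), g y

theorem trunc_pos (n : ℕ) : 0 < 1 / ((n : ℝ) + 1) := by positivity

theorem trunc_le (n : ℕ) : 1 / ((n : ℝ) + 1) ≤ (n : ℝ) + 1 := by
  rw [div_le_iff₀ (by positivity)]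
  nlinarith [(Nat.cast_nonneg n : (0 : ℝ) ≤ n)]

theorem tendsto_trunc_upper : Tendsto (fun n : ℕ => (n : ℝ) + 1) atTop atTop :=
  tendsto_atTop_add_const_right _ _ tendsto_natCast_atTop_atTop

theorem truncIntegral_sin (n : ℕ) (l : ℝ) :
    truncIntegral n (fun y => Real.sin (y * l) / y) =
      Si (((n : ℝ) + 1) * l) - Si (1 / ((n : ℝ) + 1) * l) :=
  integral_sin_mul_div _ _ _

theorem tendsto_truncIntegral_sin (l : ℝ) :
    Tendsto (fun n => truncIntegral n (fun y => Real.sin (y * l) / y)) atTop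
      (𝓝 (Real.pi / 2 * Real.sign l)) := by
  simp only [truncIntegral_sin]
  have h1 := (tendsto_Si_mul_atTop l).comp tendsto_trunc_upper
  have h2 : Tendsto (fun n : ℕ => Si (1 / ((n : ℝ) + 1) * l)) atTop (𝓝 (Si (0 * l))) :=
    (continuous_Si.tendsto _).comp (tendsto_one_div_add_atTop_nhds_zero_nat.mul_const l)
  simpa using h1.sub h2

theorem exists_abs_truncIntegral_sin_le :
    ∃ C : ℝ, ∀ n l, |truncIntegral n (fun y => Real.sin (y * l) / y)| ≤ C := by
  obtain ⟨C, hC⟩ := exists_abs_Si_le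
  refine ⟨C + C, fun n l => ?_⟩
  rw [truncIntegral_sin]
  exact (abs_sub _ _).trans (add_le_add (hC _) (hC _))

/-- If the truncated integrals of `G y z / y` converge boundedly to `J z`, they converge when
paired with an integrable function of `z`. -/
theorem tendsto_truncIntegral_pairing {X : Type*} [MeasurableSpace X] {μ : Measure X} [SFinite μ]
    {h : X → ℂ} (hh : Integrable h μ) {G : ℝ → X → ℝ} (hG : Measurable (Function.uncurry G))
    {B : ℝ} (hB : ∀ y z, |G y z| ≤ B) {C : ℝ} {J : X → ℝ}
    (hC : ∀ n z, |truncIntegral n (fun y => G y z / y)| ≤ C)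
    (hJ : ∀ z, Tendsto (fun n => truncIntegral n (fun y => G y z / y)) atTop (𝓝 (J z))) :
    Tendsto (fun n => truncIntegral n (fun y => (y : ℂ)⁻¹ * ∫ z, (G y z : ℂ) * h z ∂μ)) atTop
      (𝓝 (∫ z, (J z : ℂ) * h z ∂μ)) := by
  have hGm : Measurable fun p : ℝ × X => ((p.1 : ℂ)⁻¹ * (G p.1 p.2 : ℂ)) :=
    (Complex.measurable_ofReal.comp measurable_fst).inv.mul (Complex.measurable_ofReal.comp hG)
  have hswap : ∀ n : ℕ, truncIntegral n (fun y => (y : ℂ)⁻¹ * ∫ z, (G y z : ℂ) * h z ∂μ) =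
      ∫ z, ((truncIntegral n (fun y => G y z / y) : ℝ) : ℂ) * h z ∂μ := by
    intro n
    have e1 : truncIntegral n (fun y => (y : ℂ)⁻¹ * ∫ z, (G y z : ℂ) * h z ∂μ) =
        ∫ y in (1 / ((n : ℝ) + 1))..((n : ℝ) + 1),
          ∫ z, ((y : ℂ)⁻¹ * (G y z : ℂ)) * h z ∂μ := by
      unfold truncIntegral
      congr 1; ext y
      simp only [mul_assoc, integral_const_mul]
    rw [e1, intervalIntegral_integral_swap]
    · congr 1; ext z
      rw [intervalIntegral.integral_mul_const]
      unfold truncIntegral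
      rw [← intervalIntegral.integral_ofReal]
      congr 2; ext y
      push_cast
      rw [div_eq_inv_mul]
    · rw [uIoc_of_le (trunc_le n)]
      have hprod : Integrable (fun p : ℝ × X => h p.2)
          ((volume.restrict (Ioc (1 / ((n : ℝ) + 1)) ((n : ℝ) + 1))).prod μ) :=
        hh.comp_snd _
      -- Truncating away from `0` gives `1/y ≤ n + 1`, so `(n + 1)B` bounds the kernel and Fubini
      -- applies.
      refine (hprod.bdd_mul (c := ((n : ℝ) + 1) * B) hGm.aestronglyMeasurable ?_)
      have : ∀ᵐ p : ℝ × X ∂((volume.restrict (Ioc (1 / ((n : ℝ) + 1)) ((n : ℝ) + 1))).prod μ),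
          p.1 ∈ Ioc (1 / ((n : ℝ) + 1)) ((n : ℝ) + 1) :=
        Measure.quasiMeasurePreserving_fst.ae (ae_restrict_mem measurableSet_Ioc)
      filter_upwards [this] with p hp
      have hp0 : 0 < p.1 := (trunc_pos n).trans hp.1
      rw [norm_mul, norm_inv, Complex.norm_real, Complex.norm_real, Real.norm_eq_abs,
        Real.norm_eq_abs, abs_of_pos hp0]
      refine mul_le_mul ?_ (hB _ _) (abs_nonneg _) (by positivity)
      rw [inv_le_comm₀ hp0 (by positivity), ← one_div]
      exact hp.1.le
  simp only [hswap]
  refine tendsto_integral_of_dominated_convergence (fun z => C * ‖h z‖) (fun n => ?_)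
    (hh.norm.const_mul C) (fun n => ?_) (Eventually.of_forall fun z => ?_)
  · refine AEStronglyMeasurable.mul ?_ hh.aestronglyMeasurable
    have : StronglyMeasurable fun z => truncIntegral n (fun y => G y z / y) := by
      unfold truncIntegral
      simp only [intervalIntegral.integral_of_le (trunc_le n)]
      have : Measurable fun p : X × ℝ => G p.2 p.1 / p.2 :=
        (hG.comp measurable_swap).div measurable_snd
      exact this.stronglyMeasurable.integral_prod_right
    exact (Complex.continuous_ofReal.comp_stronglyMeasurable this).aestronglyMeasurable
  · refine Eventually.of_forall fun z => ?_
    rw [norm_mul, Complex.norm_real]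
    exact mul_le_mul_of_nonneg_right (hC n z) (norm_nonneg _)
  · exact ((Complex.continuous_ofReal.tendsto _).comp (hJ z)).mul_const _

/-! ### Functions of `aQ + bP` through the diagonalizer. -/

theorem inner_mulOp {m : ℝ → ℂ} (hm : MemLp m ∞ volume) (φ ψ : StateSpace) :
    inner ℂ φ (mulOp m hm ψ) = ∫ x, m x * (conj (φ x) * ψ x) := by
  rw [L2.inner_def]
  refine integral_congr_ae ?_
  filter_upwards [mulOp_coe m hm ψ] with x hx
  rw [hx, RCLike.inner_apply]
  ring

theorem integrable_conj_mul (φ ψ : StateSpace) :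
    Integrable (fun x => conj (φ x) * ψ x) := by
  have h := L2.integrable_inner (𝕜 := ℂ) φ ψ
  refine h.congr (Eventually.of_forall fun x => ?_)
  simp only [RCLike.inner_apply]
  ring

/-- The operator `m(aQ + bP)`, where `m` is given as a function on the spectral side of
`diagonalizer a b`. -/
def spectralMul (a b : ℝ) (m : ℝ → ℂ) (hm : MemLp m ∞ (volume : Measure ℝ)) :
    StateSpace →L[ℂ] StateSpace :=
  ((diagonalizer a b).symm.toContinuousLinearEquiv : StateSpace →L[ℂ] StateSpace) ∘L
    mulOp m hm ∘L
    ((diagonalizer a b).toContinuousLinearEquiv : StateSpace →L[ℂ] StateSpace)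

theorem spectralMul_apply (a b : ℝ) (m : ℝ → ℂ) (hm : MemLp m ∞ (volume : Measure ℝ))
    (ψ : StateSpace) :
    spectralMul a b m hm ψ = (diagonalizer a b).symm (mulOp m hm (diagonalizer a b ψ)) := rfl

theorem sgnQuadrature_eq_spectralMul (a b : ℝ) :
    sgnQuadrature a b = spectralMul a b (fun x => (Real.sign (spectralFun a b x) : ℂ))
      (memLp_sign_spectralFun a b) := rfl

theorem inner_spectralMul {a b : ℝ} {m : ℝ → ℂ} (hm : MemLp m ∞ (volume : Measure ℝ))
    (φ ψ : StateSpace) :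
    inner ℂ φ (spectralMul a b m hm ψ) =
      ∫ x, m x * (conj (diagonalizer a b φ x) * diagonalizer a b ψ x) := by
  rw [spectralMul_apply, ← inner_mulOp hm, ← LinearIsometryEquiv.inner_map_map (diagonalizer a b),
    LinearIsometryEquiv.apply_symm_apply]

theorem inner_spectralMul_left {a b : ℝ} {m : ℝ → ℝ}
    (hm : MemLp (fun x => (m x : ℂ)) ∞ (volume : Measure ℝ)) (φ ψ : StateSpace) :
    inner ℂ (spectralMul a b _ hm φ) ψ = inner ℂ φ (spectralMul a b _ hm ψ) := by
  rw [← inner_conj_symm, inner_spectralMul, inner_spectralMul, ← integral_conj]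
  congr 1; ext x
  simp only [map_mul, Complex.conj_ofReal, Complex.conj_conj]
  ring

/-! ### Weyl operators and their spectral form. -/

/-- Translation `ψ ↦ ψ(· + b)` on `L²(ℝ)`. -/
def translate (b : ℝ) : StateSpace →ₗᵢ[ℂ] StateSpace :=
  Lp.compMeasurePreservingₗᵢ ℂ (fun x : ℝ => x + b) (measurePreserving_add_right volume b)

theorem translate_coe (b : ℝ) (ψ : StateSpace) :
    translate b ψ =ᵐ[volume] fun x => ψ (x + b) :=
  Lp.coeFn_compMeasurePreserving ψ (measurePreserving_add_right volume b)

/-- The phase `x ↦ exp(i(c + dx))`. -/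
def phase (c d x : ℝ) : ℂ := Complex.exp (((c + d * x : ℝ) : ℂ) * Complex.I)

theorem norm_phase (c d x : ℝ) : ‖phase c d x‖ = 1 := Complex.norm_exp_ofReal_mul_I _

theorem continuous_phase (c d : ℝ) : Continuous (phase c d) := by
  unfold phase; fun_prop

theorem memLp_phase (c d : ℝ) : MemLp (phase c d) ∞ (volume : Measure ℝ) :=
  memLp_top_of_measurable_bound (continuous_phase c d).measurable 1 fun x => (norm_phase c d x).le

theorem fourier_translate_schwartz (b : ℝ) (φ : 𝓢(ℝ, ℂ)) (ξ : ℝ) :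
    𝓕 (φ.compSubConstCLM ℂ (-b)) ξ = phase 0 (2 * Real.pi * b) ξ * 𝓕 φ ξ := by
  rw [fourier_coe, fourier_coe, Real.fourier_real_eq_integral_exp_smul,
    Real.fourier_real_eq_integral_exp_smul]
  rw [← integral_const_mul,
    ← integral_sub_right_eq_self (fun v => phase 0 (2 * Real.pi * b) ξ * _) (-b)]
  congr 1; ext v
  simp only [compSubConstCLM_apply, smul_eq_mul, ← mul_assoc, phase]
  rw [← Complex.exp_add]
  congr 2
  push_cast
  ring

/-- Both sides are continuous in `ψ`, so the pointwise computation for Schwartz functions extends by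
density. -/
theorem fourier_translate (b : ℝ) (ψ : StateSpace) :
    Lp.fourierTransformₗᵢ ℝ ℂ (translate b ψ) =
      mulOp (phase 0 (2 * Real.pi * b)) (memLp_phase _ _) (Lp.fourierTransformₗᵢ ℝ ℂ ψ) := by
  have hd : DenseRange (SchwartzMap.toLpCLM ℂ (E := ℝ) ℂ 2 volume) :=
    SchwartzMap.denseRange_toLpCLM ENNReal.ofNat_ne_top
  refine hd.induction_on (p := fun ψ : StateSpace => Lp.fourierTransformₗᵢ ℝ ℂ (translate b ψ) =
      mulOp (phase 0 (2 * Real.pi * b)) (memLp_phase _ _) (Lp.fourierTransformₗᵢ ℝ ℂ ψ)) ψ ?_ ?_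
  · refine isClosed_eq ?_ ?_
    · exact (LinearIsometryEquiv.continuous _).comp (translate b).continuous
    · exact (mulOp _ _).continuous.comp (LinearIsometryEquiv.continuous _)
  · intro φ
    change Lp.fourierTransformₗᵢ ℝ ℂ (translate b (φ.toLp 2)) =
      mulOp (phase 0 (2 * Real.pi * b)) (memLp_phase _ _)
        (Lp.fourierTransformₗᵢ ℝ ℂ (φ.toLp 2))
    have h1 : translate b (φ.toLp 2) = (φ.compSubConstCLM ℂ (-b)).toLp 2 := by
      apply Lp.ext
      have h0 := (measurePreserving_add_right volume b).quasiMeasurePreserving.ae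
        (φ.coeFn_toLp 2 volume)
      filter_upwards [translate_coe b (φ.toLp 2), h0,
        (φ.compSubConstCLM ℂ (-b)).coeFn_toLp 2 volume] with x h1 h2 h3
      rw [h1, h2, h3, compSubConstCLM_apply, sub_neg_eq_add]
    rw [h1]
    change 𝓕 ((φ.compSubConstCLM ℂ (-b)).toLp 2) = mulOp _ _ (𝓕 (φ.toLp 2))
    rw [SchwartzMap.toLp_fourier_eq, SchwartzMap.toLp_fourier_eq]
    apply Lp.ext
    filter_upwards [mulOp_coe (phase 0 (2 * Real.pi * b)) (memLp_phase _ _) ((𝓕 φ).toLp 2),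
      (𝓕 φ).coeFn_toLp 2 volume,
      (𝓕 (φ.compSubConstCLM ℂ (-b))).coeFn_toLp 2 volume] with x h1 h2 h3
    rw [h1, h2, h3, fourier_translate_schwartz]

/-- The Weyl operator `exp(i(aQ + bP))`. -/
def weylOp (a b : ℝ) : StateSpace →L[ℂ] StateSpace :=
  mulOp (phase (a * b / 2) a) (memLp_phase _ _) ∘L (translate b).toContinuousLinearMap

theorem weylOp_coe (a b : ℝ) (ψ : StateSpace) :
    weylOp a b ψ =ᵐ[volume] fun x => phase (a * b / 2) a x * ψ (x + b) := by
  filter_upwards [mulOp_coe (phase (a * b / 2) a) (memLp_phase _ _) (translate b ψ),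
    translate_coe b ψ] with x h1 h2
  rw [← h2]
  exact h1

/-- The Weyl form of the commutation relations. The phase, half the symplectic form, changes sign
when the factors are exchanged. -/
theorem weylOp_comp (a b a' b' : ℝ) (ψ : StateSpace) :
    weylOp a b (weylOp a' b' ψ) =
      Complex.exp (((a' * b - a * b') / 2 : ℝ) * Complex.I) • weylOp (a + a') (b + b') ψ := by
  apply Lp.ext
  have h0 := (measurePreserving_add_right volume b).quasiMeasurePreserving.ae
    (weylOp_coe a' b' ψ)
  filter_upwards [weylOp_coe a b (weylOp a' b' ψ), h0, weylOp_coe (a + a') (b + b') ψ,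
    Lp.coeFn_smul (Complex.exp (((a' * b - a * b') / 2 : ℝ) * Complex.I))
      (weylOp (a + a') (b + b') ψ)] with x h1 h2 h3 h4
  rw [h1, h2, h4, Pi.smul_apply, h3, smul_eq_mul, ← mul_assoc, ← mul_assoc, add_assoc]
  congr 1
  unfold phase
  rw [← Complex.exp_add, ← Complex.exp_add]
  congr 1
  push_cast
  ring

theorem memLp_exp_spectralFun (a b x : ℝ) :
    MemLp (fun u => Complex.exp ((x * spectralFun a b u : ℝ) * Complex.I)) ∞
      (volume : Measure ℝ) := by
  refine memLp_top_of_measurable_bound ?_ 1 fun u => (Complex.norm_exp_ofReal_mul_I _).le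
  have := measurable_spectralFun a b
  fun_prop

theorem chirpUnitary_coe (c : ℝ) (ψ : StateSpace) :
    chirpUnitary c ψ =ᵐ[volume] fun x => chirp c x * ψ x :=
  mulOp_coe (chirp c) (memLp_chirp c) ψ

/-- Completing the square: the exponent `(a/b)(u + xb)²/2` is `(a/b)u²/2` plus the phase `xau +
x²ab/2` of the Weyl operator, so the chirp turns it into a pure translation. -/
theorem chirpUnitary_weylOp {a b : ℝ} (hb : b ≠ 0) (x : ℝ) (ψ : StateSpace) :
    chirpUnitary (a / b) (weylOp (x * a) (x * b) ψ) =
      translate (x * b) (chirpUnitary (a / b) ψ) := by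
  apply Lp.ext
  have h0 := (measurePreserving_add_right volume (x * b)).quasiMeasurePreserving.ae
    (chirpUnitary_coe (a / b) ψ)
  filter_upwards [chirpUnitary_coe (a / b) (weylOp (x * a) (x * b) ψ),
    weylOp_coe (x * a) (x * b) ψ, h0, translate_coe (x * b) (chirpUnitary (a / b) ψ)]
    with u h1 h2 h3 h4
  rw [h1, h2, h4, h3, ← mul_assoc]
  congr 1
  unfold phase chirp
  rw [← Complex.exp_add, ← add_mul, ← Complex.ofReal_add]
  congr 3
  field_simp
  ring

/-- Links the explicit phase-and-translation operators, usable with the Wigner function, to the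
functional calculus defining the signs. -/
theorem weylOp_eq_spectralMul (a b x : ℝ) :
    weylOp (x * a) (x * b) = spectralMul a b _ (memLp_exp_spectralFun a b x) := by
  ext1 ψ
  rw [spectralMul_apply, LinearIsometryEquiv.eq_symm_apply]
  by_cases hb : b = 0
  · subst hb
    simp only [diagonalizer, if_true, LinearIsometryEquiv.coe_refl, id]
    apply Lp.ext
    filter_upwards [weylOp_coe (x * a) (x * 0) ψ,
      mulOp_coe _ (memLp_exp_spectralFun a 0 x) ψ] with u h1 h2
    rw [h1, h2]
    simp [phase, spectralFun, mul_assoc]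
  · simp only [diagonalizer, if_neg hb, LinearIsometryEquiv.trans_apply]
    rw [chirpUnitary_weylOp hb, fourier_translate]
    congr 2
    funext u
    simp only [phase, spectralFun, if_neg hb]
    congr 2
    push_cast
    ring

/-- Split off `exp(iaQ)` and move it to the left argument; what remains is the Fourier transform of
an integrable function on the spectral side of `P`, continuous by dominated convergence. -/
theorem continuous_inner_weylOp (a : ℝ) (φ ψ : StateSpace) :
    Continuous fun b => inner ℂ φ (weylOp a b ψ) := by
  have h : ∀ b, inner ℂ φ (weylOp a b ψ) = Complex.exp ((a * b / 2 : ℝ) * Complex.I) *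
      ∫ u, Complex.exp ((b * spectralFun 0 1 u : ℝ) * Complex.I) *
        (conj (diagonalizer 0 1 ((weylOp a 0).adjoint φ) u) * diagonalizer 0 1 ψ u) := by
    intro b
    rw [← inner_spectralMul (memLp_exp_spectralFun 0 1 b), ← weylOp_eq_spectralMul,
      ContinuousLinearMap.adjoint_inner_left, mul_zero, mul_one, weylOp_comp, inner_smul_right,
      ← mul_assoc, ← Complex.exp_add, add_zero, zero_add]
    have : ((a * b / 2 : ℝ) : ℂ) * Complex.I + (((0 * 0 - a * b) / 2 : ℝ) : ℂ) * Complex.I = 0 := by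
      push_cast; ring
    rw [this, Complex.exp_zero, one_mul]
  simp only [h]
  refine Continuous.mul (by fun_prop) ?_
  have hi := integrable_conj_mul (diagonalizer 0 1 ((weylOp a 0).adjoint φ)) (diagonalizer 0 1 ψ)
  refine continuous_of_dominated (fun b => ?_) (fun b => Eventually.of_forall fun u => ?_) hi.norm
    (Eventually.of_forall fun u => by fun_prop)
  · exact (memLp_exp_spectralFun 0 1 b).aestronglyMeasurable.mul hi.aestronglyMeasurable
  · rw [norm_mul, Complex.norm_exp_ofReal_mul_I, one_mul]

theorem memLp_sin_spectralFun (a b x : ℝ) :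
    MemLp (fun u => ((Real.sin (x * spectralFun a b u) : ℝ) : ℂ)) ∞ (volume : Measure ℝ) := by
  refine memLp_top_of_measurable_bound ?_ 1 fun u => ?_
  · have := measurable_spectralFun a b
    fun_prop
  · rw [Complex.norm_real]
    exact Real.abs_sin_le_one _

/-- The operator `sin(x(aQ + bP))`. -/
def sinOp (a b x : ℝ) : StateSpace →L[ℂ] StateSpace :=
  spectralMul a b _ (memLp_sin_spectralFun a b x)

theorem sinOp_eq (a b x : ℝ) :
    sinOp a b x = (-Complex.I / 2) •
      (weylOp (x * a) (x * b) - weylOp (-x * a) (-x * b)) := by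
  ext1 ψ
  refine ext_inner_left ℂ fun φ => ?_
  have hi := integrable_conj_mul (diagonalizer a b φ) (diagonalizer a b ψ)
  have hint : ∀ y : ℝ, Integrable fun u => Complex.exp ((y * spectralFun a b u : ℝ) * Complex.I) *
      (conj (diagonalizer a b φ u) * diagonalizer a b ψ u) := fun y =>
    hi.bdd_mul (c := 1) (memLp_exp_spectralFun a b y).aestronglyMeasurable
      (Eventually.of_forall fun u => (Complex.norm_exp_ofReal_mul_I _).le)
  rw [sinOp, weylOp_eq_spectralMul, weylOp_eq_spectralMul, _root_.smul_apply, _root_.sub_apply,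
    inner_smul_right, inner_sub_right, inner_spectralMul, inner_spectralMul, inner_spectralMul,
    ← integral_sub (hint _) (hint _), ← integral_const_mul]
  congr 1; ext u
  rw [Complex.ofReal_sin, Complex.sin]
  push_cast
  simp only [neg_mul]
  ring

/-! ### The Wigner function and the symbol of a Weyl operator. -/

/-- The function `(q, x) ↦ ψ(q + x/2) conj(ψ(q - x/2))`, whose Fourier transform in `x` is the
Wigner function. -/
def correlation (ψ : StateSpace) (q x : ℝ) : ℂ := ψ (q + x / 2) * conj (ψ (q - x / 2))

theorem measurable_coe (ψ : StateSpace) : Measurable ψ := (Lp.stronglyMeasurable ψ).measurable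

theorem measurable_correlation (ψ : StateSpace) :
    Measurable (Function.uncurry (correlation ψ)) := by
  have h := measurable_coe ψ
  have h1 : Measurable fun z : ℝ × ℝ => ψ (z.1 + z.2 / 2) := h.comp (by fun_prop)
  have h2 : Measurable fun z : ℝ × ℝ => ψ (z.1 - z.2 / 2) := h.comp (by fun_prop)
  exact h1.mul (Complex.continuous_conj.measurable.comp h2)

theorem norm_correlation_le (ψ : StateSpace) (q x : ℝ) :
    ‖correlation ψ q x‖ ≤ (‖ψ (q + x / 2)‖ ^ 2 + ‖ψ (q - x / 2)‖ ^ 2) / 2 := by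
  rw [correlation, norm_mul, RCLike.norm_conj]
  nlinarith [sq_nonneg (‖ψ (q + x / 2)‖ - ‖ψ (q - x / 2)‖)]

theorem integrable_norm_sq (ψ : StateSpace) : Integrable fun u => ‖ψ u‖ ^ 2 :=
  (Lp.memLp ψ).integrable_norm_pow (by norm_num)

theorem integrable_correlation_right (ψ : StateSpace) (q : ℝ) :
    Integrable (correlation ψ q) := by
  have h := integrable_norm_sq ψ
  have h1 : Integrable fun x : ℝ => ‖ψ (q + x / 2)‖ ^ 2 :=
    (h.comp_add_left q).comp_div (R := 2) (by norm_num)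
  have h2 : Integrable fun x : ℝ => ‖ψ (q - x / 2)‖ ^ 2 :=
    (h.comp_sub_left q).comp_div (R := 2) (by norm_num)
  refine ((h1.add h2).div_const 2).mono' ?_ (Eventually.of_forall (norm_correlation_le ψ q))
  exact ((measurable_correlation ψ).comp measurable_prodMk_left).aestronglyMeasurable

theorem integrable_correlation_left (ψ : StateSpace) (x : ℝ) :
    Integrable (fun q => correlation ψ q x) := by
  have h := integrable_norm_sq ψ
  refine (((h.comp_add_right (x / 2)).add (h.comp_sub_right (x / 2))).div_const 2).mono' ?_
    (Eventually.of_forall fun q => norm_correlation_le ψ q x)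
  exact ((measurable_correlation ψ).comp measurable_prodMk_right).aestronglyMeasurable

theorem integral_norm_correlation_le (ψ : StateSpace) (x : ℝ) :
    ∫ q, ‖correlation ψ q x‖ ≤ ∫ u, ‖ψ u‖ ^ 2 := by
  have h := integrable_norm_sq ψ
  have h1 := h.comp_add_right (x / 2)
  have h2 := h.comp_sub_right (x / 2)
  refine (integral_mono (integrable_correlation_left ψ x).norm ((h1.add h2).div_const 2)
    fun q => norm_correlation_le ψ q x).trans_eq ?_
  rw [integral_div]
  simp only [Pi.add_apply]
  rw [integral_add h1 h2, integral_add_right_eq_self (fun u => ‖ψ u‖ ^ 2),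
    integral_sub_right_eq_self (fun u => ‖ψ u‖ ^ 2)]
  ring

theorem wigner_eq_fourier (ψ : StateSpace) (q p : ℝ) :
    wigner ψ (q, p) = (1 / (2 * Real.pi) : ℂ) * 𝓕 (correlation ψ q) (p / (2 * Real.pi)) := by
  rw [wigner, Real.fourier_real_eq_integral_exp_smul]
  congr 2; ext x
  rw [smul_eq_mul, mul_comm]
  unfold correlation
  congr 2
  have : (Real.pi : ℂ) ≠ 0 := by exact_mod_cast Real.pi_ne_zero
  push_cast
  field_simp

theorem fourierInv_schwartz_eq (φ : 𝓢(ℝ, ℂ)) (p : ℝ) :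
    𝓕⁻ φ (p / (2 * Real.pi)) = ∫ b, φ b * Complex.exp ((b * p : ℝ) * Complex.I) := by
  rw [fourierInv_coe, Real.fourierInv_eq']
  congr 1; ext x
  rw [smul_eq_mul, mul_comm]
  congr 3
  have := Real.pi_ne_zero
  simp only [RCLike.inner_apply, conj_trivial]
  field_simp

/-- The multiplication formula `∫ (𝓕f) g = ∫ f (𝓕g)` moves the transform onto the Schwartz function,
so only integrability of the correlation in `x` is needed. -/
theorem integral_wigner_mul (ψ : StateSpace) (φ : 𝓢(ℝ, ℂ)) (q : ℝ) :
    ∫ p, wigner ψ (q, p) * 𝓕⁻ φ (p / (2 * Real.pi)) = ∫ x, correlation ψ q x * φ x := by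
  have hpi : (0 : ℝ) < 2 * Real.pi := by positivity
  have h1 : ∀ p, wigner ψ (q, p) * 𝓕⁻ φ (p / (2 * Real.pi)) = (1 / (2 * Real.pi) : ℂ) *
      (fun ξ => 𝓕 (correlation ψ q) ξ * 𝓕⁻ φ ξ) (p / (2 * Real.pi)) := fun p => by
    rw [wigner_eq_fourier, mul_assoc]
  simp only [h1]
  rw [integral_const_mul, Measure.integral_comp_div (fun ξ => 𝓕 (correlation ψ q) ξ * 𝓕⁻ φ ξ),
    abs_of_pos hpi]
  have h2 := VectorFourier.integral_fourierIntegral_smul_eq_flip (L := innerₗ ℝ)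
    (μ := volume) (ν := volume) Real.continuous_fourierChar continuous_inner
    (integrable_correlation_right ψ q) (𝓕⁻ φ).integrable
  have h3 : ∫ ξ, 𝓕 (correlation ψ q) ξ * 𝓕⁻ φ ξ = ∫ x, correlation ψ q x * 𝓕 (𝓕⁻ φ) x := by
    simp only [smul_eq_mul, flip_innerₗ] at h2
    rw [fourier_coe]
    exact h2
  rw [h3, FourierTransform.fourier_fourierInv_eq, Complex.real_smul, ← mul_assoc]
  push_cast
  have : (2 * Real.pi : ℂ) ≠ 0 := by exact_mod_cast hpi.ne'
  rw [one_div, inv_mul_cancel₀ this, one_mul]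

theorem inner_weylOp (a b : ℝ) (ψ : StateSpace) :
    inner ℂ ψ (weylOp a b ψ) =
      ∫ q, Complex.exp ((a * q : ℝ) * Complex.I) * correlation ψ q b := by
  have h1 : inner ℂ ψ (weylOp a b ψ) = ∫ u, phase (a * b / 2) a u * (ψ (u + b) * conj (ψ u)) := by
    rw [L2.inner_def]
    refine integral_congr_ae ?_
    filter_upwards [weylOp_coe a b ψ] with u hu
    rw [RCLike.inner_apply, hu]
    ring
  -- Shifting by `b/2` centres the pair `u, u + b` at `q` and cancels the phase `ab/2`.
  rw [h1, ← integral_sub_right_eq_self _ (b / 2)]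
  congr 1; ext q
  unfold phase correlation
  congr 2
  · push_cast; ring
  · rw [show q - b / 2 + b = q + b / 2 by ring]

/-- The function `(q, p) ↦ exp(i(aq + bp))`. -/
def planeWave (a b : ℝ) (z : ℝ × ℝ) : ℂ :=
  Complex.exp ((a * z.1 + b * z.2 : ℝ) * Complex.I)

theorem norm_planeWave (a b : ℝ) (z : ℝ × ℝ) : ‖planeWave a b z‖ = 1 :=
  Complex.norm_exp_ofReal_mul_I _

theorem continuous_planeWave (a b : ℝ) : Continuous (planeWave a b) := by
  unfold planeWave; fun_prop

theorem integrable_planeWave_mul {W : ℝ × ℝ → ℂ} (hW : Integrable W) (a b : ℝ) :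
    Integrable fun z => planeWave a b z * W z :=
  hW.bdd_mul (c := 1) (continuous_planeWave a b).aestronglyMeasurable
    (Eventually.of_forall fun z => (norm_planeWave a b z).le)

theorem continuous_integral_planeWave {W : ℝ × ℝ → ℂ} (hW : Integrable W) (a : ℝ) :
    Continuous fun b => ∫ z, planeWave a b z * W z := by
  refine continuous_of_dominated (fun b => (integrable_planeWave_mul hW a b).aestronglyMeasurable)
    (fun b => Eventually.of_forall fun z => ?_) hW.norm (Eventually.of_forall fun z => ?_)
  · rw [norm_mul, norm_planeWave, one_mul]
  · unfold planeWave; fun_prop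

/-- Smearing in `b` turns the oscillation in `p` into a Schwartz factor, to which
`integral_wigner_mul` can be applied. -/
theorem integral_schwartz_mul_planeWave {W : ℝ × ℝ → ℂ} (hW : Integrable W) (a : ℝ)
    (φ : 𝓢(ℝ, ℂ)) :
    ∫ b, φ b * ∫ z, planeWave a b z * W z =
      ∫ z : ℝ × ℝ, Complex.exp ((a * z.1 : ℝ) * Complex.I) *
        (W z * 𝓕⁻ φ (z.2 / (2 * Real.pi))) := by
  simp only [← integral_const_mul]
  rw [integral_integral_swap]
  · congr 1; ext z
    rw [fourierInv_schwartz_eq, ← integral_const_mul, ← integral_const_mul]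
    congr 1; ext b
    unfold planeWave
    rw [Complex.ofReal_add, add_mul, Complex.exp_add]
    ring
  · have h := φ.integrable.mul_prod (μ := volume) hW
    have hc : Continuous fun p : ℝ × (ℝ × ℝ) => planeWave a p.1 p.2 := by
      unfold planeWave; fun_prop
    refine (h.bdd_mul (c := 1) hc.aestronglyMeasurable
      (Eventually.of_forall fun p => (norm_planeWave _ _ _).le)).congr
      (Eventually.of_forall fun p => ?_)
    simp only [Function.uncurry]
    ring

theorem integral_schwartz_mul_inner_weylOp (ψ : StateSpace) (a : ℝ) (φ : 𝓢(ℝ, ℂ)) :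
    ∫ b, φ b * inner ℂ ψ (weylOp a b ψ) =
      ∫ q, Complex.exp ((a * q : ℝ) * Complex.I) * ∫ x, correlation ψ q x * φ x := by
  simp only [inner_weylOp, ← integral_const_mul]
  rw [integral_integral_swap]
  · congr 1; ext q
    congr 1; ext x
    ring
  · have hm : Measurable (Function.uncurry fun b q : ℝ =>
        φ b * (Complex.exp ((a * q : ℝ) * Complex.I) * correlation ψ q b)) := by
      have h1 : Measurable fun z : ℝ × ℝ => correlation ψ z.2 z.1 :=
        (measurable_correlation ψ).comp measurable_swap
      have h2 : Measurable fun z : ℝ × ℝ => φ z.1 := φ.continuous.measurable.comp measurable_fst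
      have h3 : Continuous fun z : ℝ × ℝ => Complex.exp ((a * z.2 : ℝ) * Complex.I) := by fun_prop
      exact h2.mul (h3.measurable.mul h1)
    have hnorm : ∀ b q, ‖φ b * (Complex.exp ((a * q : ℝ) * Complex.I) * correlation ψ q b)‖ =
        ‖φ b‖ * ‖correlation ψ q b‖ := fun b q => by
      rw [norm_mul, norm_mul, Complex.norm_exp_ofReal_mul_I, one_mul]
    rw [integrable_prod_iff hm.aestronglyMeasurable]
    refine ⟨Eventually.of_forall fun b => ?_, ?_⟩
    · refine Integrable.const_mul (f := fun q : ℝ => Complex.exp ((a * q : ℝ) * Complex.I) *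
        correlation ψ q b) ?_ (φ b)
      exact (integrable_correlation_left ψ b).bdd_mul (c := 1)
        (by fun_prop : Continuous fun q : ℝ =>
          Complex.exp ((a * q : ℝ) * Complex.I)).aestronglyMeasurable
        (Eventually.of_forall fun q => (Complex.norm_exp_ofReal_mul_I _).le)
    · refine (φ.integrable.norm.mul_const (∫ u, ‖ψ u‖ ^ 2)).mono'
        (hm.norm.stronglyMeasurable.integral_prod_right).aestronglyMeasurable
        (Eventually.of_forall fun b => ?_)
      rw [Real.norm_of_nonneg (integral_nonneg fun _ => norm_nonneg _)]
      simp only [Function.uncurry, hnorm]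
      rw [integral_const_mul]
      exact mul_le_mul_of_nonneg_left (integral_norm_correlation_le ψ b) (norm_nonneg _)

/-- The Weyl symbol of `exp(i(aQ + bP))` is `exp(i(aq + bp))`. -/
theorem integral_planeWave_mul_wigner {ψ : StateSpace} (hW : Integrable (wigner ψ)) (a b : ℝ) :
    ∫ z, planeWave a b z * wigner ψ z = inner ℂ ψ (weylOp a b ψ) := by
  have hF := continuous_integral_planeWave hW a
  have hG := continuous_inner_weylOp a ψ ψ
  -- Rather than inverting a Fourier transform pointwise, both sides are tested against smooth
  -- compactly supported functions of `b`; continuity then upgrades the almost everywhere equality.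
  have hae : ∀ᵐ b : ℝ, (∫ z, planeWave a b z * wigner ψ z) = inner ℂ ψ (weylOp a b ψ) := by
    refine ae_eq_of_integral_contDiff_smul_eq hF.locallyIntegrable hG.locallyIntegrable ?_
    intro g hg hgs
    have hcd : ContDiff ℝ ((⊤ : ℕ∞) : WithTop ℕ∞) (fun x => (g x : ℂ)) :=
      Complex.ofRealCLM.contDiff.comp hg
    have hcs : HasCompactSupport (fun x => (g x : ℂ)) :=
      hgs.comp_left (g := fun r : ℝ => (r : ℂ)) Complex.ofReal_zero
    let φ : 𝓢(ℝ, ℂ) := hcs.toSchwartzMap hcd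
    have hφ : ∀ x, φ x = g x := fun x => rfl
    have e1 := integral_schwartz_mul_planeWave hW a φ
    have e2 := integral_schwartz_mul_inner_weylOp ψ a φ
    simp only [hφ] at e1 e2
    simp only [Complex.real_smul]
    rw [e1, e2]
    have hint : Integrable fun z : ℝ × ℝ => Complex.exp ((a * z.1 : ℝ) * Complex.I) *
        (wigner ψ z * 𝓕⁻ φ (z.2 / (2 * Real.pi))) := by
      obtain ⟨C, hC⟩ : ∃ C : ℝ, ∀ x, ‖𝓕⁻ φ x‖ ≤ C :=
        ⟨_, fun x => by simpa using (SchwartzMap.norm_le_seminorm ℝ (𝓕⁻ φ) x)⟩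
      have hcF : Continuous fun z : ℝ × ℝ => 𝓕⁻ φ (z.2 / (2 * Real.pi)) :=
        (𝓕⁻ φ).continuous.comp (by fun_prop)
      have h1 : Integrable fun z : ℝ × ℝ => wigner ψ z * 𝓕⁻ φ (z.2 / (2 * Real.pi)) :=
        hW.mul_bdd (c := C) hcF.aestronglyMeasurable (Eventually.of_forall fun z => hC _)
      exact h1.bdd_mul (c := 1) (by fun_prop : Continuous fun z : ℝ × ℝ =>
          Complex.exp ((a * z.1 : ℝ) * Complex.I)).aestronglyMeasurable
        (Eventually.of_forall fun q => (Complex.norm_exp_ofReal_mul_I _).le)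
    rw [Measure.volume_eq_prod] at hint ⊢
    rw [integral_prod _ hint]
    congr 1; ext q
    simp only
    rw [integral_const_mul, integral_wigner_mul]
    rfl
  exact congrFun ((hF.ae_eq_iff_eq volume hG).mp hae) b

/-! ### The scalar integral that produces `Si`. -/

theorem measurable_real_sign : Measurable Real.sign := by
  unfold Real.sign
  exact Measurable.ite measurableSet_Iio measurable_const
    (Measurable.ite measurableSet_Ioi measurable_const measurable_const)

theorem abs_real_sign_le (x : ℝ) : |Real.sign x| ≤ 1 := by
  rcases Real.sign_apply_eq x with h | h | h <;> simp [h]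

theorem intervalIntegrable_indicator_sin (l c a b : ℝ) :
    IntervalIntegrable ((Iic c).indicator fun u : ℝ => Real.sin (u * l) / u) volume a b := by
  have h := intervalIntegrable_sin_mul_div l a b
  exact ⟨h.1.indicator measurableSet_Iic, h.2.indicator measurableSet_Iic⟩

theorem integral_zero_indicator_sin {c R : ℝ} (l : ℝ) (hc : 0 ≤ c) (hR : 0 ≤ R) :
    ∫ u in (0 : ℝ)..R, (Iic c).indicator (fun u : ℝ => Real.sin (u * l) / u) u =
      Si (min R c * l) := by
  have key : ∀ r, 0 ≤ r → r ≤ c →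
      ∫ u in (0 : ℝ)..r, (Iic c).indicator (fun u : ℝ => Real.sin (u * l) / u) u = Si (r * l) := by
    intro r h0 h1
    rw [← integral_zero_sin_mul_div]
    refine intervalIntegral.integral_congr_ae (Eventually.of_forall fun u hu => ?_)
    rw [uIoc_of_le h0] at hu
    exact indicator_of_mem (mem_Iic.mpr (hu.2.trans h1)) _
  rcases le_total R c with h | h
  · rw [min_eq_left h, key R hR h]
  · rw [min_eq_right h, ← intervalIntegral.integral_add_adjacent_intervals
      (intervalIntegrable_indicator_sin l c 0 c) (intervalIntegrable_indicator_sin l c c R),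
      key c hc le_rfl, add_eq_left, ← intervalIntegral.integral_zero (a := c) (b := R)]
    refine intervalIntegral.integral_congr_ae (Eventually.of_forall fun u hu => ?_)
    rw [uIoc_of_le h] at hu
    exact indicator_of_notMem (s := Iic c) (not_le.mpr hu.1) _

theorem truncIntegral_indicator_sin {c : ℝ} (l : ℝ) (hc : 0 ≤ c) (n : ℕ) :
    truncIntegral n ((Iic c).indicator fun u : ℝ => Real.sin (u * l) / u) =
      Si (min ((n : ℝ) + 1) c * l) - Si (min (1 / ((n : ℝ) + 1)) c * l) := by
  rw [← integral_zero_indicator_sin l hc (by positivity),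
    ← integral_zero_indicator_sin l hc (trunc_pos n).le,
    intervalIntegral.integral_interval_sub_left] <;> first
  | rfl
  | exact intervalIntegrable_indicator_sin _ _ _ _

/-- A shift smaller than `|β|` leaves both signs equal to that of `β`; a larger one makes them
opposite. At `τ = |β|` one sign can be `0` and the other not, hence the exclusion. -/
theorem sign_add_sign_sub_of_pos {β τ : ℝ} (hτ : 0 < τ) (hne : τ ≠ |β|) :
    Real.sign (β + τ) + Real.sign (β - τ) = if τ ≤ |β| then 2 * Real.sign β else 0 := by
  split_ifs with h
  · have h : τ < |β| := lt_of_le_of_ne h hne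
    rcases lt_abs.mp h with h' | h'
    · rw [Real.sign_of_pos (by linarith), Real.sign_of_pos (by linarith),
        Real.sign_of_pos (by linarith)]; ring
    · rw [Real.sign_of_neg (by linarith), Real.sign_of_neg (by linarith),
        Real.sign_of_neg (by linarith)]; ring
  · have h := abs_lt.mp (not_le.mp h)
    rw [Real.sign_of_pos (by linarith [h.1]), Real.sign_of_neg (by linarith [h.2])]; ring

theorem sign_add_sign_sub {β σ x : ℝ} (hσ : σ ≠ 0) (hx : 0 < x) (hne : x ≠ 2 * |β| / |σ|) :
    Real.sign (β + x * σ / 2) + Real.sign (β - x * σ / 2) =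
      if x ≤ 2 * |β| / |σ| then 2 * Real.sign β else 0 := by
  have hσ' : 0 < |σ| := abs_pos.mpr hσ
  have hiff : x ≤ 2 * |β| / |σ| ↔ x * |σ| / 2 ≤ |β| := by
    rw [le_div_iff₀ hσ', div_le_iff₀ (by norm_num), mul_comm 2]
  have hne' : x * |σ| / 2 ≠ |β| := by
    intro h
    apply hne
    rw [← h]
    field_simp
  have h := sign_add_sign_sub_of_pos (by positivity) hne'
  simp only [hiff]
  rw [← h]
  -- Reversing the sign of `σ` merely swaps the two summands.
  rcases abs_choice σ with h' | h' <;> rw [h']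
  rw [show β + x * -σ / 2 = β - x * σ / 2 by ring, show β - x * -σ / 2 = β + x * σ / 2 by ring,
    add_comm]

theorem truncIntegral_sin_mul_sign {σ : ℝ} (hσ : σ ≠ 0) (α β : ℝ) (n : ℕ) :
    truncIntegral n (fun x => Real.sin (x * α) *
        (Real.sign (β + x * σ / 2) + Real.sign (β - x * σ / 2)) / x) =
      2 * Real.sign β * (Si (min ((n : ℝ) + 1) (2 * |β| / |σ|) * α) -
        Si (min (1 / ((n : ℝ) + 1)) (2 * |β| / |σ|) * α)) := by
  rw [← truncIntegral_indicator_sin α (by positivity) n]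
  unfold truncIntegral
  rw [← intervalIntegral.integral_const_mul]
  refine intervalIntegral.integral_congr_ae ?_
  filter_upwards [compl_mem_ae_iff.mpr (measure_singleton (2 * |β| / |σ|))] with x hx hx'
  rw [uIoc_of_le (trunc_le n)] at hx'
  rw [sign_add_sign_sub hσ ((trunc_pos n).trans hx'.1) hx]
  simp only [indicator, mem_Iic]
  split_ifs <;> ring

/-- Oddness of `Si` absorbs the sign and turns `|β|` into `β`. -/
theorem sign_mul_Si (α β σ : ℝ) :
    Real.sign β * Si (2 * |β| / |σ| * α) = Si (2 / |σ| * α * β) := by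
  rcases lt_trichotomy β 0 with h | rfl | h
  · rw [Real.sign_of_neg h, abs_of_neg h, neg_one_mul, ← Si_neg]
    congr 1; ring
  · simp
  · rw [Real.sign_of_pos h, abs_of_pos h, one_mul]
    congr 1; ring

theorem tendsto_truncIntegral_sin_mul_sign {σ : ℝ} (hσ : σ ≠ 0) (α β : ℝ) :
    Tendsto (fun n => truncIntegral n (fun x => Real.sin (x * α) *
        (Real.sign (β + x * σ / 2) + Real.sign (β - x * σ / 2)) / x)) atTop
      (𝓝 (2 * Si (2 / |σ| * α * β))) := by
  simp only [truncIntegral_sin_mul_sign hσ]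
  have hc : 0 ≤ 2 * |β| / |σ| := by positivity
  have h1 : Tendsto (fun n : ℕ => Si (min ((n : ℝ) + 1) (2 * |β| / |σ|) * α)) atTop
      (𝓝 (Si (2 * |β| / |σ| * α))) := by
    -- Once `n + 1` passes the cutoff `2|β|/|σ|`, the upper endpoint no longer depends on `n`.
    refine tendsto_const_nhds.congr' ?_
    filter_upwards [tendsto_trunc_upper.eventually_ge_atTop (2 * |β| / |σ|)] with n hn
    rw [min_eq_right hn]
  have h2 : Tendsto (fun n : ℕ => Si (min (1 / ((n : ℝ) + 1)) (2 * |β| / |σ|) * α)) atTop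
      (𝓝 (Si (min 0 (2 * |β| / |σ|) * α))) :=
    (continuous_Si.tendsto _).comp
      ((tendsto_one_div_add_atTop_nhds_zero_nat.min tendsto_const_nhds).mul_const α)
  rw [min_eq_left hc, zero_mul, Si_zero] at h2
  have h3 := (h1.sub h2).const_mul (2 * Real.sign β)
  rwa [sub_zero, mul_assoc, sign_mul_Si] at h3

theorem exists_abs_truncIntegral_sin_mul_sign_le {σ : ℝ} (hσ : σ ≠ 0) :
    ∃ C : ℝ, ∀ α β n, |truncIntegral n (fun x => Real.sin (x * α) *
        (Real.sign (β + x * σ / 2) + Real.sign (β - x * σ / 2)) / x)| ≤ C := by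
  obtain ⟨C, hC⟩ := exists_abs_Si_le
  refine ⟨2 * 1 * (C + C), fun α β n => ?_⟩
  rw [truncIntegral_sin_mul_sign hσ, abs_mul, abs_mul, abs_two]
  refine mul_le_mul (mul_le_mul_of_nonneg_left (abs_real_sign_le β) (by norm_num)) ?_
    (abs_nonneg _) (by norm_num)
  exact (abs_sub _ _).trans (add_le_add (hC _) (hC _))

/-! ### Symbols of symmetrized products: sine–sine, sine–sign, sign–sign. -/

/-- The density on the spectral side of `aQ + bP` for which integrating `m` gives
`⟨φ, m(aQ + bP) ψ⟩ + ⟨m(aQ + bP) ψ, φ⟩`. -/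
def spectralDensity (a b : ℝ) (φ ψ : StateSpace) (u : ℝ) : ℂ :=
  conj (diagonalizer a b φ u) * diagonalizer a b ψ u +
    conj (diagonalizer a b ψ u) * diagonalizer a b φ u

theorem integrable_spectralDensity (a b : ℝ) (φ ψ : StateSpace) :
    Integrable (spectralDensity a b φ ψ) :=
  (integrable_conj_mul _ _).add (integrable_conj_mul _ _)

theorem inner_add_inner_spectralMul {a b : ℝ} {m : ℝ → ℝ}
    (hm : MemLp (fun x => (m x : ℂ)) ∞ (volume : Measure ℝ)) {B : ℝ} (hB : ∀ x, |m x| ≤ B)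
    (φ ψ : StateSpace) :
    inner ℂ φ (spectralMul a b _ hm ψ) + inner ℂ (spectralMul a b _ hm ψ) φ =
      ∫ u, (m u : ℂ) * spectralDensity a b φ ψ u := by
  have hint : ∀ φ ψ : StateSpace, Integrable fun u =>
      (m u : ℂ) * (conj (diagonalizer a b φ u) * diagonalizer a b ψ u) := fun φ ψ =>
    (integrable_conj_mul _ _).bdd_mul (c := B) hm.aestronglyMeasurable
      (Eventually.of_forall fun u => by rw [Complex.norm_real]; exact hB u)
  rw [inner_spectralMul_left, inner_spectralMul, inner_spectralMul,
    ← integral_add (hint _ _) (hint _ _)]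
  simp only [spectralDensity, mul_add]

/-- The Dirichlet integral on the spectral side. Both orders of the inner product are kept together
because the phase-space formulas describe symmetrized products. -/
theorem tendsto_truncIntegral_inner_sinOp (a b : ℝ) (φ ψ : StateSpace) :
    Tendsto (fun n => truncIntegral n (fun y => (y : ℂ)⁻¹ *
        (inner ℂ φ (sinOp a b y ψ) + inner ℂ (sinOp a b y ψ) φ))) atTop
      (𝓝 ((Real.pi / 2 : ℝ) *
        (inner ℂ φ (sgnQuadrature a b ψ) + inner ℂ (sgnQuadrature a b ψ) φ))) := by
  obtain ⟨C, hC⟩ := exists_abs_truncIntegral_sin_le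
  have h := tendsto_truncIntegral_pairing (integrable_spectralDensity a b φ ψ)
    (G := fun y u => Real.sin (y * spectralFun a b u)) (B := 1) (C := C)
    (J := fun u => Real.pi / 2 * Real.sign (spectralFun a b u))
    (by
      have := measurable_spectralFun a b
      unfold Function.uncurry
      fun_prop)
    (fun y z => Real.abs_sin_le_one _) (fun n z => hC n _)
    (fun z => tendsto_truncIntegral_sin _)
  rw [sgnQuadrature_eq_spectralMul, inner_add_inner_spectralMul (memLp_sign_spectralFun a b)
    (fun x => abs_real_sign_le _), ← integral_const_mul]
  simp only [sinOp, inner_add_inner_spectralMul (memLp_sin_spectralFun a b _)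
    (fun x => Real.abs_sin_le_one _)]
  simpa only [Complex.ofReal_mul, mul_assoc] using h

theorem inner_weylOp_weylOp {ψ : StateSpace} (hW : Integrable (wigner ψ)) (a b a' b' : ℝ) :
    inner ℂ ψ (weylOp a b (weylOp a' b' ψ)) =
      Complex.exp (((a' * b - a * b') / 2 : ℝ) * Complex.I) *
        ∫ z, planeWave (a + a') (b + b') z * wigner ψ z := by
  rw [weylOp_comp, inner_smul_right, integral_planeWave_mul_wigner hW]

/-- Expanding the sines into exponentials gives the same four plane waves for either order, with
phases `exp(±ixyσ/2)` exchanged between the orders; adding the orders leaves `2 cos(xyσ/2)`. -/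
theorem inner_sinOp_sinOp {ψ : StateSpace} (hW : Integrable (wigner ψ)) (a b a' b' x y : ℝ) :
    inner ℂ (sinOp a b x ψ) (sinOp a' b' y ψ) + inner ℂ (sinOp a' b' y ψ) (sinOp a b x ψ) =
      ∫ z : ℝ × ℝ, ((2 * Real.sin (x * (a * z.1 + b * z.2)) * Real.sin (y * (a' * z.1 + b' * z.2)) *
        Real.cos (x * y * (a * b' - a' * b) / 2) : ℝ) : ℂ) * wigner ψ z := by
  have hadj : ∀ a b x φ χ, inner ℂ (sinOp a b x φ) χ = inner ℂ φ (sinOp a b x χ) :=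
    fun a b x φ χ => inner_spectralMul_left (memLp_sin_spectralFun a b x) φ χ
  rw [hadj, hadj]
  set K : ℂ := Complex.exp (((x * y * (a * b' - a' * b) / 2 : ℝ) : ℂ) * Complex.I) with hK
  set K' : ℂ := Complex.exp (-((x * y * (a * b' - a' * b) / 2 : ℝ) : ℂ) * Complex.I) with hK'
  have hI := fun u v : ℝ => integrable_planeWave_mul hW (u * a + v * a') (u * b + v * b')
  have h1 : ∀ u v : ℝ, inner ℂ ψ (weylOp (u * a) (u * b) (weylOp (v * a') (v * b') ψ)) =
      Complex.exp (-((u * v * (a * b' - a' * b) / 2 : ℝ) : ℂ) * Complex.I) *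
        ∫ z, planeWave (u * a + v * a') (u * b + v * b') z * wigner ψ z := fun u v => by
    rw [inner_weylOp_weylOp hW]
    congr 3
    push_cast; ring
  have h2 : ∀ u v : ℝ, inner ℂ ψ (weylOp (v * a') (v * b') (weylOp (u * a) (u * b) ψ)) =
      Complex.exp (((u * v * (a * b' - a' * b) / 2 : ℝ) : ℂ) * Complex.I) *
        ∫ z, planeWave (u * a + v * a') (u * b + v * b') z * wigner ψ z := fun u v => by
    rw [inner_weylOp_weylOp hW, add_comm (v * a'), add_comm (v * b')]
    congr 3
    push_cast; ring
  simp only [sinOp_eq, _root_.smul_apply, _root_.sub_apply, map_smul, map_sub, inner_smul_right,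
    inner_sub_right, h1, h2]
  have e1 : ((-x * -y * (a * b' - a' * b) / 2 : ℝ) : ℂ) =
    ((x * y * (a * b' - a' * b) / 2 : ℝ) : ℂ) := by push_cast; ring
  have e2 : ((-x * y * (a * b' - a' * b) / 2 : ℝ) : ℂ) =
    -((x * y * (a * b' - a' * b) / 2 : ℝ) : ℂ) := by push_cast; ring
  have e3 : ((x * -y * (a * b' - a' * b) / 2 : ℝ) : ℂ) =
    -((x * y * (a * b' - a' * b) / 2 : ℝ) : ℂ) := by push_cast; ring
  simp only [e1, e2, e3, neg_neg, ← hK, ← hK']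
  -- The `-1/4` is `(-i/2)²` from the two sines; `K + K'` is twice the cosine.
  have hsplit : ∀ z : ℝ × ℝ, ((2 * Real.sin (x * (a * z.1 + b * z.2)) *
      Real.sin (y * (a' * z.1 + b' * z.2)) *
        Real.cos (x * y * (a * b' - a' * b) / 2) : ℝ) : ℂ) * wigner ψ z =
      (-(K + K') / 4) * ((planeWave (x * a + y * a') (x * b + y * b') z * wigner ψ z -
        planeWave (x * a + -y * a') (x * b + -y * b') z * wigner ψ z) -
        (planeWave (-x * a + y * a') (-x * b + y * b') z * wigner ψ z -
        planeWave (-x * a + -y * a') (-x * b + -y * b') z * wigner ψ z)) := by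
    intro z
    simp only [← sub_mul]
    rw [← mul_assoc]
    congr 1
    have hp : ∀ u v : ℝ, planeWave (u * a + v * a') (u * b + v * b') z =
        Complex.exp ((u * (a * z.1 + b * z.2) : ℝ) * Complex.I) *
          Complex.exp ((v * (a' * z.1 + b' * z.2) : ℝ) * Complex.I) := fun u v => by
      rw [planeWave, ← Complex.exp_add]
      congr 1
      push_cast; ring
    simp only [hp]
    simp only [neg_mul x, neg_mul y, Complex.ofReal_neg]
    push_cast [-Complex.ofReal_add, -Complex.ofReal_sub]
    rw [Complex.sin, Complex.sin, Complex.cos, hK, hK']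
    push_cast
    ring_nf
    simp only [Complex.I_sq]
    ring
  simp only [hsplit]
  rw [integral_const_mul, integral_sub, integral_sub (hI _ _) (hI _ _),
    integral_sub (hI _ _) (hI _ _)]
  · ring_nf
    simp only [Complex.I_sq]
    ring
  · exact (hI _ _).sub (hI _ _)
  · exact (hI _ _).sub (hI _ _)

theorem truncIntegral_sin_mul_sin_mul_cos (n : ℕ) (c β τ : ℝ) :
    truncIntegral n (fun y => 2 * c * Real.sin (y * β) * Real.cos (y * τ) / y) =
      c * (truncIntegral n (fun y => Real.sin (y * (β + τ)) / y) +
        truncIntegral n (fun y => Real.sin (y * (β - τ)) / y)) := by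
  unfold truncIntegral
  rw [← intervalIntegral.integral_add (intervalIntegrable_sin_mul_div _ _ _)
    (intervalIntegrable_sin_mul_div _ _ _), ← intervalIntegral.integral_const_mul]
  congr 1; ext y
  simp only [mul_add y, mul_sub y, Real.sin_add, Real.sin_sub]
  ring

/-- The Weyl symbol of the symmetrized product of `sin(x(aQ + bP))` and `sgn(a'Q + b'P)`. -/
theorem inner_sinOp_sgnQuadrature {ψ : StateSpace} (hW : Integrable (wigner ψ))
    (a b a' b' x : ℝ) :
    inner ℂ (sgnQuadrature a' b' ψ) (sinOp a b x ψ) +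
        inner ℂ (sinOp a b x ψ) (sgnQuadrature a' b' ψ) =
      ∫ z : ℝ × ℝ, ((Real.sin (x * (a * z.1 + b * z.2)) *
        (Real.sign (a' * z.1 + b' * z.2 + x * (a * b' - a' * b) / 2) +
          Real.sign (a' * z.1 + b' * z.2 - x * (a * b' - a' * b) / 2)) : ℝ) : ℂ) *
        wigner ψ z := by
  obtain ⟨C, hC⟩ := exists_abs_truncIntegral_sin_le
  have hC0 : 0 ≤ C := (abs_nonneg _).trans (hC 0 0)
  -- The left vector is the fixed state `sin(x(aQ + bP))ψ`, and only the second sine is sent to a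
  -- sign. The same truncated quantities are then evaluated in phase space, giving a second limit.
  have hlim := tendsto_truncIntegral_inner_sinOp a' b' (sinOp a b x ψ) ψ
  simp only [inner_sinOp_sinOp hW] at hlim
  have heq : ∀ n (z : ℝ × ℝ), truncIntegral n (fun y => 2 * Real.sin (x * (a * z.1 + b * z.2)) *
      Real.sin (y * (a' * z.1 + b' * z.2)) * Real.cos (x * y * (a * b' - a' * b) / 2) / y) =
      Real.sin (x * (a * z.1 + b * z.2)) *
      (truncIntegral n (fun y => Real.sin
          (y * (a' * z.1 + b' * z.2 + x * (a * b' - a' * b) / 2)) / y) +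
        truncIntegral n (fun y => Real.sin
          (y * (a' * z.1 + b' * z.2 - x * (a * b' - a' * b) / 2)) / y)) := fun n z => by
    rw [← truncIntegral_sin_mul_sin_mul_cos]
    congr 1; ext y
    rw [show x * y * (a * b' - a' * b) / 2 = y * (x * (a * b' - a' * b) / 2) by ring]
  have hlim' := tendsto_truncIntegral_pairing hW
    (G := fun y z => 2 * Real.sin (x * (a * z.1 + b * z.2)) *
      Real.sin (y * (a' * z.1 + b' * z.2)) * Real.cos (x * y * (a * b' - a' * b) / 2))
    (B := 2) (C := 1 * (C + C))
    (J := fun z => Real.pi / 2 * (Real.sin (x * (a * z.1 + b * z.2)) *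
        (Real.sign (a' * z.1 + b' * z.2 + x * (a * b' - a' * b) / 2) +
          Real.sign (a' * z.1 + b' * z.2 - x * (a * b' - a' * b) / 2))))
    (by unfold Function.uncurry; fun_prop)
    (fun y z => by
      rw [abs_mul, abs_mul, abs_mul, abs_two]
      have h1 := Real.abs_sin_le_one (x * (a * z.1 + b * z.2))
      have h2 := Real.abs_sin_le_one (y * (a' * z.1 + b' * z.2))
      have h3 := Real.abs_cos_le_one (x * y * (a * b' - a' * b) / 2)
      have h4 := mul_le_one₀ h1 (abs_nonneg _) h2
      have h5 := mul_le_one₀ h4 (abs_nonneg _) h3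
      linarith)
    (fun n z => by
      rw [heq, abs_mul]
      exact mul_le_mul (Real.abs_sin_le_one _)
        ((abs_add_le _ _).trans (add_le_add (hC _ _) (hC _ _))) (abs_nonneg _) zero_le_one)
    (fun z => by
      simp only [heq]
      have := ((tendsto_truncIntegral_sin
        (a' * z.1 + b' * z.2 + x * (a * b' - a' * b) / 2)).add (tendsto_truncIntegral_sin
        (a' * z.1 + b' * z.2 - x * (a * b' - a' * b) / 2))).const_mul
          (Real.sin (x * (a * z.1 + b * z.2)))
      convert this using 2
      ring)
  have h := tendsto_nhds_unique hlim hlim'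
  simp only [Complex.ofReal_mul (Real.pi / 2), mul_assoc ((Real.pi / 2 : ℝ) : ℂ)] at h
  rw [integral_const_mul] at h
  have hpi : ((Real.pi / 2 : ℝ) : ℂ) ≠ 0 := by
    exact_mod_cast (by positivity : Real.pi / 2 ≠ 0)
  rw [add_comm]
  exact mul_left_cancel₀ hpi h

theorem inner_sgnQuadrature_sgnQuadrature {ψ : StateSpace} (hW : Integrable (wigner ψ))
    {a b a' b' : ℝ} (hσ : a * b' - a' * b ≠ 0) :
    inner ℂ (sgnQuadrature a' b' ψ) (sgnQuadrature a b ψ) +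
        inner ℂ (sgnQuadrature a b ψ) (sgnQuadrature a' b' ψ) =
      2 * ∫ z : ℝ × ℝ, ((2 / Real.pi * Si (2 / |a * b' - a' * b| * (a * z.1 + b * z.2) *
        (a' * z.1 + b' * z.2)) : ℝ) : ℂ) * wigner ψ z := by
  obtain ⟨C, hC⟩ := exists_abs_truncIntegral_sin_mul_sign_le hσ
  -- Now the remaining sine is integrated, with the sign already obtained in the left vector.
  have hlim := tendsto_truncIntegral_inner_sinOp a b (sgnQuadrature a' b' ψ) ψ
  simp only [inner_sinOp_sgnQuadrature hW] at hlim
  have hlim' := tendsto_truncIntegral_pairing hW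
    (G := fun x z => Real.sin (x * (a * z.1 + b * z.2)) *
        (Real.sign (a' * z.1 + b' * z.2 + x * (a * b' - a' * b) / 2) +
          Real.sign (a' * z.1 + b' * z.2 - x * (a * b' - a' * b) / 2)))
    (B := 1 * (1 + 1)) (C := C)
    (J := fun z => 2 * Si (2 / |a * b' - a' * b| * (a * z.1 + b * z.2) * (a' * z.1 + b' * z.2)))
    (by
      unfold Function.uncurry
      refine Measurable.mul (by fun_prop) (Measurable.add ?_ ?_)
      · exact measurable_real_sign.comp (by fun_prop)
      · exact measurable_real_sign.comp (by fun_prop))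
    (fun y z => by
      rw [abs_mul]
      exact mul_le_mul (Real.abs_sin_le_one _)
        ((abs_add_le _ _).trans (add_le_add (abs_real_sign_le _) (abs_real_sign_le _)))
        (abs_nonneg _) zero_le_one)
    (fun n z => hC _ _ _)
    (fun z => tendsto_truncIntegral_sin_mul_sign hσ _ _)
  have h := tendsto_nhds_unique hlim hlim'
  have hpi : ((Real.pi / 2 : ℝ) : ℂ) ≠ 0 := by
    exact_mod_cast (by positivity : Real.pi / 2 ≠ 0)
  refine mul_left_cancel₀ hpi (h.trans ?_)
  rw [← integral_const_mul, ← integral_const_mul]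
  congr 1; ext z
  have : (Real.pi : ℂ) ≠ 0 := by exact_mod_cast Real.pi_ne_zero
  push_cast
  field_simp

/-- The Weyl symbol of the symmetrized product of `sgn(aQ + bP)` and `sgn(a'Q + b'P)`. -/
theorem integral_Si_mul_wigner {ψ : StateSpace} (hW : Integrable (wigner ψ))
    {a b a' b' : ℝ} (hσ : a * b' - a' * b ≠ 0) :
    ∫ z : ℝ × ℝ, ((2 / Real.pi * Si (2 / |a * b' - a' * b| * (a * z.1 + b * z.2) *
        (a' * z.1 + b' * z.2)) : ℝ) : ℂ) * wigner ψ z =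
      inner ℂ ψ (symProd (sgnQuadrature a b) (sgnQuadrature a' b') ψ) := by
  have h := inner_sgnQuadrature_sgnQuadrature hW hσ
  have hadj : ∀ a b φ χ, inner ℂ (sgnQuadrature a b φ) χ = inner ℂ φ (sgnQuadrature a b χ) :=
    fun a b φ χ => inner_spectralMul_left (memLp_sign_spectralFun a b) φ χ
  rw [hadj, hadj] at h
  rw [symProd, _root_.smul_apply, _root_.add_apply, inner_smul_right, inner_add_right]
  change _ = 1 / 2 * (inner ℂ ψ (sgnQuadrature a b (sgnQuadrature a' b' ψ)) +
    inner ℂ ψ (sgnQuadrature a' b' (sgnQuadrature a b ψ)))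
  linear_combination (-1 / 2 : ℂ) * h

/-! ### Density of the states with integrable Wigner function. -/

theorem stronglyMeasurable_wigner (ψ : StateSpace) : StronglyMeasurable (wigner ψ) := by
  unfold wigner
  refine StronglyMeasurable.const_mul ?_ _
  have h1 : Measurable fun w : (ℝ × ℝ) × ℝ => correlation ψ w.1.1 w.2 :=
    (measurable_correlation ψ).comp
      ((measurable_fst.comp measurable_fst).prodMk measurable_snd)
  have h2 : Continuous fun w : (ℝ × ℝ) × ℝ =>
      Complex.exp (-Complex.I * (w.1.2 * w.2 : ℝ)) := by fun_prop
  exact (h1.mul h2.measurable).stronglyMeasurable.integral_prod_right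

theorem quasiMeasurePreserving_mul_left {c : ℝ} (hc : c ≠ 0) :
    Measure.QuasiMeasurePreserving (fun x : ℝ => c * x) volume volume := by
  refine ⟨by fun_prop, ?_⟩
  rw [Real.map_volume_mul_left hc]
  exact Measure.smul_absolutelyContinuous

/-- The function `x ↦ χ(q + x/2) conj(η(q - x/2))`. -/
def crossCorrelation (χ η : 𝓢(ℝ, ℂ)) (q x : ℝ) : ℂ := χ (q + x / 2) * conj (η (q - x / 2))

theorem correlation_toLp_ae_eq (φ : 𝓢(ℝ, ℂ)) (q : ℝ) :
    correlation (φ.toLp 2) q =ᵐ[volume] crossCorrelation φ φ q := by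
  have h := φ.coeFn_toLp 2 volume
  have h1 := (quasiMeasurePreserving_mul_left (c := 1 / 2) (by norm_num)).ae
    ((measurePreserving_add_left volume q).quasiMeasurePreserving.ae h)
  have h2 := (quasiMeasurePreserving_mul_left (c := -(1 / 2)) (by norm_num)).ae
    ((measurePreserving_add_left volume q).quasiMeasurePreserving.ae h)
  filter_upwards [h1, h2] with x hx1 hx2
  rw [show q + 1 / 2 * x = q + x / 2 by ring] at hx1
  rw [show q + -(1 / 2) * x = q - x / 2 by ring] at hx2
  rw [correlation, hx1, hx2, crossCorrelation]

/-- Differentiating in `x` hits one slot at a time, so two independent functions are needed for the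
class to be closed under derivatives. -/
theorem hasDerivAt_crossCorrelation (χ η : 𝓢(ℝ, ℂ)) (q x : ℝ) :
    HasDerivAt (crossCorrelation χ η q)
      (1 / 2 * (crossCorrelation (derivCLM ℂ ℂ χ) η q x -
        crossCorrelation χ (derivCLM ℂ ℂ η) q x)) x := by
  have h1 : HasDerivAt (fun x : ℝ => q + x / 2) (1 / 2) x :=
    ((hasDerivAt_id x).div_const 2).const_add q
  have h2 : HasDerivAt (fun x : ℝ => q - x / 2) (-(1 / 2)) x :=
    ((hasDerivAt_id x).div_const 2).const_sub q
  have h3 := (χ.hasDerivAt (q + x / 2)).scomp x h1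
  have h4 := ((η.hasDerivAt (q - x / 2)).scomp x h2).star
  have h5 := h3.mul h4
  refine h5.congr_deriv ?_
  simp only [crossCorrelation, derivCLM_apply, Function.comp, Complex.real_smul,
    RCLike.star_def, map_mul, Complex.conj_ofReal]
  push_cast
  ring

theorem exists_schwartz_bound (χ : 𝓢(ℝ, ℂ)) :
    ∃ C : ℝ, 0 ≤ C ∧ ∀ u, (1 + u ^ 2) ^ 2 * ‖χ u‖ ≤ C := by
  obtain ⟨C0, h0⟩ := χ.decay 0 0
  obtain ⟨C4, h4⟩ := χ.decay 4 0
  refine ⟨2 * (C0 + C4), ?_, fun u => ?_⟩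
  · have h1 := (by positivity : (0 : ℝ) ≤ _).trans (h0.2 0)
    have h2 := (by positivity : (0 : ℝ) ≤ _).trans (h4.2 0)
    linarith
  · have h1 := h0.2 u
    have h2 := h4.2 u
    simp only [norm_iteratedFDeriv_zero, pow_zero, one_mul, Real.norm_eq_abs] at h1 h2
    rw [show |u| ^ 4 = u ^ 4 from Even.pow_abs (by decide) u] at h2
    have h3 : (1 + u ^ 2) ^ 2 ≤ 2 * (1 + u ^ 4) := by nlinarith [sq_nonneg (u ^ 2 - 1)]
    have h4 := mul_le_mul_of_nonneg_right h3 (norm_nonneg (χ u))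
    nlinarith

/-- With `u, v = q ± x/2`, `(1 + u²)(1 + v²) ≥ 1 + u² + v² = 1 + 2q² + x²/2`. The square of this
controls `(1 + q²)(1 + x²)` up to the factor `2`, hence the weight `(1 + u²)²` on each function. -/
theorem exists_crossCorrelation_bound (χ η : 𝓢(ℝ, ℂ)) :
    ∃ C : ℝ, ∀ q x, ‖crossCorrelation χ η q x‖ ≤ C * (1 + q ^ 2)⁻¹ * (1 + x ^ 2)⁻¹ := by
  obtain ⟨C1, hC1, h1⟩ := exists_schwartz_bound χ
  obtain ⟨C2, hC2, h2⟩ := exists_schwartz_bound η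
  refine ⟨2 * (C1 * C2), fun q x => ?_⟩
  rw [crossCorrelation, norm_mul, RCLike.norm_conj, mul_assoc, ← mul_inv, ← div_eq_mul_inv,
    le_div_iff₀ (by positivity)]
  have h := mul_le_mul (h1 (q + x / 2)) (h2 (q - x / 2)) (by positivity) hC1
  set s := ‖χ (q + x / 2)‖
  set t := ‖η (q - x / 2)‖
  have hst : 0 ≤ s * t := mul_nonneg (norm_nonneg _) (norm_nonneg _)
  have hb : 1 + 2 * q ^ 2 + x ^ 2 / 2 ≤
      (1 + (q + x / 2) ^ 2) * (1 + (q - x / 2) ^ 2) := by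
    nlinarith [mul_nonneg (sq_nonneg (q + x / 2)) (sq_nonneg (q - x / 2))]
  have hb2 : (1 + q ^ 2) * (1 + x ^ 2) ≤
      2 * ((1 + (q + x / 2) ^ 2) * (1 + (q - x / 2) ^ 2)) ^ 2 := by
    have h3 : (1 + 2 * q ^ 2 + x ^ 2 / 2) ^ 2 ≤
        ((1 + (q + x / 2) ^ 2) * (1 + (q - x / 2) ^ 2)) ^ 2 :=
      pow_le_pow_left₀ (by positivity) hb 2
    have h4 : (1 + q ^ 2) * ((1 + x ^ 2) / 2) ≤ (1 + 2 * q ^ 2 + x ^ 2 / 2) ^ 2 := by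
      rw [sq (1 + 2 * q ^ 2 + x ^ 2 / 2)]
      refine mul_le_mul ?_ ?_ (by positivity) (by positivity) <;>
        linarith [sq_nonneg q, sq_nonneg x]
    linarith
  calc s * t * ((1 + q ^ 2) * (1 + x ^ 2))
      ≤ s * t * (2 * ((1 + (q + x / 2) ^ 2) * (1 + (q - x / 2) ^ 2)) ^ 2) :=
        mul_le_mul_of_nonneg_left hb2 hst
    _ = 2 * (((1 + (q + x / 2) ^ 2) ^ 2 * s) * ((1 + (q - x / 2) ^ 2) ^ 2 * t)) := by ring
    _ ≤ 2 * (C1 * C2) := by linarith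

theorem continuous_crossCorrelation (χ η : 𝓢(ℝ, ℂ)) (q : ℝ) :
    Continuous (crossCorrelation χ η q) :=
  (χ.continuous.comp (by fun_prop)).mul
    (Complex.continuous_conj.comp (η.continuous.comp (by fun_prop)))

theorem integrable_crossCorrelation (χ η : 𝓢(ℝ, ℂ)) (q : ℝ) :
    Integrable (crossCorrelation χ η q) := by
  obtain ⟨C, hC⟩ := exists_crossCorrelation_bound χ η
  exact (integrable_inv_one_add_sq.const_mul (C * (1 + q ^ 2)⁻¹)).mono'
    (continuous_crossCorrelation χ η q).aestronglyMeasurable (Eventually.of_forall (hC q))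

theorem exists_fourier_crossCorrelation_bound (χ η : 𝓢(ℝ, ℂ)) :
    ∃ C : ℝ, ∀ q ξ, ‖𝓕 (crossCorrelation χ η q) ξ‖ ≤ C * (1 + q ^ 2)⁻¹ := by
  obtain ⟨C, hC⟩ := exists_crossCorrelation_bound χ η
  refine ⟨C * Real.pi, fun q ξ => ?_⟩
  refine (VectorFourier.norm_fourierIntegral_le_integral_norm _ _ _ _ _).trans ?_
  refine (integral_mono (integrable_crossCorrelation χ η q).norm
    (integrable_inv_one_add_sq.const_mul (C * (1 + q ^ 2)⁻¹)) (hC q)).trans_eq ?_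
  rw [integral_const_mul, integral_univ_inv_one_add_sq]
  ring

theorem fourier_crossCorrelation_deriv (χ η : 𝓢(ℝ, ℂ)) (q ξ : ℝ) :
    (2 * Real.pi * Complex.I * ξ) * 𝓕 (crossCorrelation χ η q) ξ =
      1 / 2 * (𝓕 (crossCorrelation (derivCLM ℂ ℂ χ) η q) ξ -
        𝓕 (crossCorrelation χ (derivCLM ℂ ℂ η) q) ξ) := by
  have hd : deriv (crossCorrelation χ η q) = fun x =>
      1 / 2 * (crossCorrelation (derivCLM ℂ ℂ χ) η q x -
        crossCorrelation χ (derivCLM ℂ ℂ η) q x) :=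
    funext fun x => (hasDerivAt_crossCorrelation χ η q x).deriv
  have hi1 := integrable_crossCorrelation (derivCLM ℂ ℂ χ) η q
  have hi2 := integrable_crossCorrelation χ (derivCLM ℂ ℂ η) q
  have h := congrFun (Real.fourier_deriv (integrable_crossCorrelation χ η q)
    (fun x => (hasDerivAt_crossCorrelation χ η q x).differentiableAt)
    (by rw [hd]; exact (hi1.sub hi2).const_mul _)) ξ
  rw [smul_eq_mul] at h
  rw [← h, hd, Real.fourier_eq, Real.fourier_eq, Real.fourier_eq,
    ← integral_sub ((Real.fourierIntegral_convergent_iff ξ).2 hi1)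
      ((Real.fourierIntegral_convergent_iff ξ).2 hi2), ← integral_const_mul]
  congr 1; ext x
  simp only [Circle.smul_def, smul_eq_mul]
  ring

/-- Two integrations by parts trade `(2πξ)²` for cross-correlations of derivatives, each with
transform bounded by a multiple of `(1 + q²)⁻¹`. -/
theorem exists_fourier_crossCorrelation_decay (φ : 𝓢(ℝ, ℂ)) :
    ∃ C : ℝ, ∀ q ξ, ‖𝓕 (crossCorrelation φ φ q) ξ‖ ≤
      C * ((1 + q ^ 2)⁻¹ * (1 + (2 * Real.pi * ξ) ^ 2)⁻¹) := by
  set φ₁ := derivCLM ℂ ℂ φ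
  obtain ⟨C0, h0⟩ := exists_fourier_crossCorrelation_bound φ φ
  obtain ⟨C1, h1⟩ := exists_fourier_crossCorrelation_bound (derivCLM ℂ ℂ φ₁) φ
  obtain ⟨C2, h2⟩ := exists_fourier_crossCorrelation_bound φ₁ φ₁
  obtain ⟨C3, h3⟩ := exists_fourier_crossCorrelation_bound φ (derivCLM ℂ ℂ φ₁)
  refine ⟨C0 + 1 / 4 * (C1 + 2 * C2 + C3), fun q ξ => ?_⟩
  have e : -((2 * Real.pi * ξ : ℝ) : ℂ) ^ 2 * 𝓕 (crossCorrelation φ φ q) ξ =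
      1 / 4 * (𝓕 (crossCorrelation (derivCLM ℂ ℂ φ₁) φ q) ξ -
        2 * 𝓕 (crossCorrelation φ₁ φ₁ q) ξ + 𝓕 (crossCorrelation φ (derivCLM ℂ ℂ φ₁) q) ξ) := by
    have d0 := fourier_crossCorrelation_deriv φ φ q ξ
    have d1 := fourier_crossCorrelation_deriv φ₁ φ q ξ
    have d2 := fourier_crossCorrelation_deriv φ φ₁ q ξ
    have e0 : -((2 * Real.pi * ξ : ℝ) : ℂ) ^ 2 =
        (2 * Real.pi * Complex.I * ξ) * (2 * Real.pi * Complex.I * ξ) := by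
      push_cast
      ring_nf
      simp only [Complex.I_sq]
      ring
    rw [e0]
    linear_combination (2 * Real.pi * Complex.I * ξ) * d0 + 1 / 2 * d1 - 1 / 2 * d2
  have hn : (2 * Real.pi * ξ) ^ 2 * ‖𝓕 (crossCorrelation φ φ q) ξ‖ ≤
      1 / 4 * (C1 + 2 * C2 + C3) * (1 + q ^ 2)⁻¹ := by
    have hl : ‖-((2 * Real.pi * ξ : ℝ) : ℂ) ^ 2 * 𝓕 (crossCorrelation φ φ q) ξ‖ =
        (2 * Real.pi * ξ) ^ 2 * ‖𝓕 (crossCorrelation φ φ q) ξ‖ := by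
      rw [norm_mul, norm_neg, norm_pow, Complex.norm_real, Real.norm_eq_abs, sq_abs]
    rw [← hl, e, norm_mul]
    have ht := (norm_add_le (𝓕 (crossCorrelation (derivCLM ℂ ℂ φ₁) φ q) ξ -
        2 * 𝓕 (crossCorrelation φ₁ φ₁ q) ξ) (𝓕 (crossCorrelation φ (derivCLM ℂ ℂ φ₁) q) ξ))
    have ht2 := norm_sub_le (𝓕 (crossCorrelation (derivCLM ℂ ℂ φ₁) φ q) ξ)
        (2 * 𝓕 (crossCorrelation φ₁ φ₁ q) ξ)
    rw [norm_mul, Complex.norm_ofNat] at ht2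
    have hq : ‖(1 / 4 : ℂ)‖ = 1 / 4 := by norm_num
    rw [hq]
    linarith [h1 q ξ, h2 q ξ, h3 q ξ]
  rw [← mul_assoc, ← div_eq_mul_inv, le_div_iff₀ (by positivity)]
  linarith [h0 q ξ]

theorem integrable_wigner_toLp (φ : 𝓢(ℝ, ℂ)) :
    Integrable (wigner (φ.toLp 2)) (volume : Measure (ℝ × ℝ)) := by
  obtain ⟨C, hC⟩ := exists_fourier_crossCorrelation_decay φ
  have hi : Integrable (fun z : ℝ × ℝ => (1 + z.1 ^ 2)⁻¹ * (1 + z.2 ^ 2)⁻¹) :=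
    integrable_inv_one_add_sq.mul_prod integrable_inv_one_add_sq
  refine (hi.const_mul (1 / (2 * Real.pi) * C)).mono'
    (stronglyMeasurable_wigner _).aestronglyMeasurable (Eventually.of_forall fun z => ?_)
  obtain ⟨q, p⟩ := z
  have h := hC q (p / (2 * Real.pi))
  rw [mul_div_cancel₀ p (by positivity)] at h
  rw [wigner_eq_fourier, Real.fourier_congr_ae (correlation_toLp_ae_eq φ q), norm_mul, mul_assoc]
  have hn : ‖(1 / (2 * Real.pi) : ℂ)‖ = 1 / (2 * Real.pi) := by
    rw [norm_div, norm_mul, norm_one, Complex.norm_ofNat, Complex.norm_real,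
      Real.norm_of_nonneg Real.pi_pos.le]
  rw [hn]
  exact mul_le_mul_of_nonneg_left h (by positivity)

theorem sphere_subset_closure_wignerIntegrableStates :
    Metric.sphere (0 : StateSpace) 1 ⊆ closure wignerIntegrableStates := by
  intro ψ hψ
  have hψ1 : ‖ψ‖ = 1 := by simpa using hψ
  have hd : DenseRange (SchwartzMap.toLpCLM ℂ (E := ℝ) ℂ 2 volume) :=
    SchwartzMap.denseRange_toLpCLM ENNReal.ofNat_ne_top
  have hfreq := mem_closure_iff_frequently.mp (hd ψ)
  have hne : ∀ᶠ χ : StateSpace in 𝓝 ψ, χ ≠ 0 :=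
    isOpen_ne.mem_nhds (norm_ne_zero_iff.mp (by rw [hψ1]; exact one_ne_zero))
  -- Normalization is continuous at the unit vector `ψ` and fixes it, so Schwartz approximants
  -- remain approximants after rescaling to norm one.
  have hN : Tendsto (fun χ : StateSpace => ((‖χ‖⁻¹ : ℝ) : ℂ) • χ) (𝓝 ψ) (𝓝 ψ) := by
    have h1 : ContinuousAt (fun χ : StateSpace => ((‖χ‖⁻¹ : ℝ) : ℂ) • χ) ψ :=
      (Complex.continuous_ofReal.continuousAt.comp
        (continuous_norm.continuousAt.inv₀ (by rw [hψ1]; exact one_ne_zero))).smul continuousAt_id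
    have h2 := h1.tendsto
    simpa [hψ1] using h2
  rw [mem_closure_iff_frequently]
  refine hN.frequently ((hfreq.and_eventually hne).mono ?_)
  rintro χ ⟨⟨φ, rfl⟩, hχ⟩
  refine ⟨?_, ?_⟩
  · rw [norm_smul, Complex.norm_real, norm_inv, norm_norm,
      inv_mul_cancel₀ (norm_ne_zero_iff.mpr hχ)]
  · rw [← map_smul]
    exact integrable_wigner_toLp _

/-! ### Assembly of the Weyl transforms and the square of `A`. -/

theorem isWeylTransform_symProd {a b a' b' : ℝ} (hσ : a * b' - a' * b ≠ 0) :
    IsWeylTransform (fun z => 2 / Real.pi * Si (2 / |a * b' - a' * b| *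
      (a * z.1 + b * z.2) * (a' * z.1 + b' * z.2)))
      (symProd (sgnQuadrature a b) (sgnQuadrature a' b')) where
  measurable := (continuous_const.mul (continuous_Si.comp (by fun_prop))).measurable
  bounded := by
    obtain ⟨C, hC⟩ := exists_abs_Si_le
    refine ⟨2 / Real.pi * C, fun z => ?_⟩
    rw [abs_mul, abs_of_pos (by positivity : 0 < 2 / Real.pi)]
    exact mul_le_mul_of_nonneg_left (hC _) (by positivity)
  dense := sphere_subset_closure_wignerIntegrableStates
  integral_eq ψ hψ := integral_Si_mul_wigner hψ.2 hσ

theorem IsWeylTransform.add {f g : ℝ × ℝ → ℝ} {A B : StateSpace →L[ℂ] StateSpace}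
    (hf : IsWeylTransform f A) (hg : IsWeylTransform g B) :
    IsWeylTransform (fun z => f z + g z) (A + B) where
  measurable := hf.measurable.add hg.measurable
  bounded := by
    obtain ⟨C, hC⟩ := hf.bounded
    obtain ⟨D, hD⟩ := hg.bounded
    exact ⟨C + D, fun z => (abs_add_le _ _).trans (add_le_add (hC z) (hD z))⟩
  dense := hf.dense
  integral_eq ψ hψ := by
    have hint : ∀ {h : ℝ × ℝ → ℝ} {T : StateSpace →L[ℂ] StateSpace}, IsWeylTransform h T →
        Integrable fun z => (h z : ℂ) * wigner ψ z := by
      intro h T hh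
      obtain ⟨C, hC⟩ := hh.bounded
      exact hψ.2.bdd_mul (c := C)
        (Complex.measurable_ofReal.comp hh.measurable).aestronglyMeasurable
        (Eventually.of_forall fun z => by
          rw [Complex.norm_real]
          exact hC z)
    rw [_root_.add_apply, inner_add_right, ← hf.integral_eq ψ hψ, ← hg.integral_eq ψ hψ,
      ← integral_add (hint hf) (hint hg)]
    congr 1; ext z
    push_cast
    ring

theorem isWeylTransform_sgnQt {s t : ℝ} (h : Real.sin (t - s) ≠ 0) :
    IsWeylTransform
      (fun z => 2 / Real.pi * Si (2 / |Real.sin (t - s)| *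
        (z.1 * Real.cos s + z.2 * Real.sin s) * (z.1 * Real.cos t + z.2 * Real.sin t)))
      (symProd (sgnQt s) (sgnQt t)) := by
  have e : Real.cos s * Real.sin t - Real.cos t * Real.sin s = Real.sin (t - s) := by
    rw [Real.sin_sub]; ring
  have h' := isWeylTransform_symProd (e.trans_ne h)
  rw [e] at h'
  simpa only [mul_comm (Real.cos _), mul_comm (Real.sin _)] using! h'

/-- The spectral function vanishes only at `x = 0`, a null set, so the squared sign is `1` almost
everywhere. -/
theorem sgnQuadrature_mul_self {a b : ℝ} (h : a ≠ 0 ∨ b ≠ 0) :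
    sgnQuadrature a b * sgnQuadrature a b = 1 := by
  ext1 ψ
  change spectralMul a b _ (memLp_sign_spectralFun a b)
    (spectralMul a b _ (memLp_sign_spectralFun a b) ψ) = ψ
  rw [spectralMul_apply, spectralMul_apply, LinearIsometryEquiv.apply_symm_apply,
    LinearIsometryEquiv.symm_apply_eq]
  apply Lp.ext
  filter_upwards [mulOp_coe _ (memLp_sign_spectralFun a b)
      (mulOp _ (memLp_sign_spectralFun a b) (diagonalizer a b ψ)),
    mulOp_coe _ (memLp_sign_spectralFun a b) (diagonalizer a b ψ),
    compl_mem_ae_iff.mpr (measure_singleton (0 : ℝ))] with x h1 h2 hx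
  have hx : x ≠ 0 := hx
  have hne : spectralFun a b x ≠ 0 := by
    unfold spectralFun
    split_ifs with hb
    · exact mul_ne_zero (h.resolve_right (not_not.mpr hb)) hx
    · exact mul_ne_zero (mul_ne_zero (by positivity) hb) hx
  have hs : (Real.sign (spectralFun a b x) : ℂ) * (Real.sign (spectralFun a b x) : ℂ) = 1 := by
    rcases Real.sign_apply_eq_of_ne_zero _ hne with hs | hs <;> rw [hs] <;> norm_num
  rw [h1, h2, ← mul_assoc, hs, one_mul]

theorem sgnQt_mul_self (t : ℝ) : sgnQt t * sgnQt t = 1 := by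
  refine sgnQuadrature_mul_self ?_
  by_contra! h
  have := Real.sin_sq_add_cos_sq t
  rw [h.1, h.2] at this
  norm_num at this

theorem half_smul_opA_sq_sub :
    (1 / 2 : ℂ) • (opA ^ 2 - 3) =
      symProd (sgnQt 0) (sgnQt (2 * Real.pi / 3)) +
      symProd (sgnQt 0) (sgnQt (4 * Real.pi / 3)) +
      symProd (sgnQt (2 * Real.pi / 3)) (sgnQt (4 * Real.pi / 3)) := by
  unfold opA symProd
  rw [← smul_add, ← smul_add]
  congr 1
  have hX := sgnQt_mul_self 0
  have hY := sgnQt_mul_self (2 * Real.pi / 3)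
  have hZ := sgnQt_mul_self (4 * Real.pi / 3)
  generalize sgnQt 0 = X at *
  generalize sgnQt (2 * Real.pi / 3) = Y at *
  generalize sgnQt (4 * Real.pi / 3) = Z at *
  have h : (X + Y + Z) ^ 2 = X * X + Y * Y + Z * Z +
      (X * Y + Y * X + (X * Z + Z * X) + (Y * Z + Z * Y)) := by
    noncomm_ring
  rw [h, hX, hY, hZ, show (1 + 1 + 1 : StateSpace →L[ℂ] StateSpace) = 3 by norm_num,
    add_sub_cancel_left]

theorem cos_two_pi_div_three : Real.cos (2 * Real.pi / 3) = -1 / 2 := by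
  rw [show 2 * Real.pi / 3 = Real.pi - Real.pi / 3 by ring, Real.cos_pi_sub, Real.cos_pi_div_three]
  norm_num

theorem sin_two_pi_div_three : Real.sin (2 * Real.pi / 3) = √3 / 2 := by
  rw [show 2 * Real.pi / 3 = Real.pi - Real.pi / 3 by ring, Real.sin_pi_sub, Real.sin_pi_div_three]

theorem cos_four_pi_div_three : Real.cos (4 * Real.pi / 3) = -1 / 2 := by
  rw [show 4 * Real.pi / 3 = Real.pi / 3 + Real.pi by ring, Real.cos_add_pi, Real.cos_pi_div_three]
  norm_num

theorem sin_four_pi_div_three : Real.sin (4 * Real.pi / 3) = -(√3 / 2) := by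
  rw [show 4 * Real.pi / 3 = Real.pi / 3 + Real.pi by ring, Real.sin_add_pi, Real.sin_pi_div_three]

theorem isWeylTransform_opA :
    IsWeylTransform
      (fun z =>
        2 / Real.pi * Si (4 / √3 * z.1 * ((-z.1 + z.2 * √3) / 2)) +
        2 / Real.pi * Si (4 / √3 * z.1 * ((-z.1 - z.2 * √3) / 2)) +
        2 / Real.pi * Si (4 / √3 * ((-z.1 + z.2 * √3) / 2) * ((-z.1 - z.2 * √3) / 2)))
      ((1 / 2 : ℂ) • (opA ^ 2 - 3)) := by
  have h3 : (0 : ℝ) < √3 := by positivity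
  have e1 : Real.sin (2 * Real.pi / 3 - 0) = √3 / 2 := by rw [sub_zero, sin_two_pi_div_three]
  have e2 : Real.sin (4 * Real.pi / 3 - 0) = -(√3 / 2) := by rw [sub_zero, sin_four_pi_div_three]
  have e3 : Real.sin (4 * Real.pi / 3 - 2 * Real.pi / 3) = √3 / 2 := by
    rw [show 4 * Real.pi / 3 - 2 * Real.pi / 3 = 2 * Real.pi / 3 by ring, sin_two_pi_div_three]
  have h1 := isWeylTransform_sgnQt (s := 0) (t := 2 * Real.pi / 3) (by rw [e1]; positivity)
  have h2 := isWeylTransform_sgnQt (s := 0) (t := 4 * Real.pi / 3)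
    (by rw [e2]; exact neg_ne_zero.mpr (by positivity))
  have h3' := isWeylTransform_sgnQt (s := 2 * Real.pi / 3) (t := 4 * Real.pi / 3)
    (by rw [e3]; positivity)
  have h := (h1.add h2).add h3'
  rw [half_smul_opA_sq_sub]
  refine Eq.mp (congrArg (IsWeylTransform · _) ?_) h
  funext z
  -- All three angle differences have sine `±√3/2`, so one constant serves every term.
  have habs : 2 / |√3 / 2| = 4 / √3 := by
    rw [abs_of_pos (by positivity)]
    field_simp
    norm_num
  simp only [e1, e2, e3, abs_neg, habs, Real.cos_zero, Real.sin_zero, cos_two_pi_div_three,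
    sin_two_pi_div_three, cos_four_pi_div_three, sin_four_pi_div_three]
  congr 4 <;> ring_nf

end Oscillator

end

open Oscillator in
theorem lemma2p2 :
    IsWeylTransform (fun z => 2 / Real.pi * Si (2 * z.1 * z.2)) (symProd sgnQ sgnP) ∧
    (∀ s t : ℝ, Real.sin (t - s) ≠ 0 →
      IsWeylTransform
        (fun z => 2 / Real.pi * Si (2 / |Real.sin (t - s)| *
          (z.1 * Real.cos s + z.2 * Real.sin s) * (z.1 * Real.cos t + z.2 * Real.sin t)))
        (symProd (sgnQt s) (sgnQt t))) ∧
    (1 / 2 : ℂ) • (opA ^ 2 - 3) =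
      symProd (sgnQt 0) (sgnQt (2 * Real.pi / 3)) +
      symProd (sgnQt 0) (sgnQt (4 * Real.pi / 3)) +
      symProd (sgnQt (2 * Real.pi / 3)) (sgnQt (4 * Real.pi / 3)) ∧
    IsWeylTransform
      (fun z =>
        2 / Real.pi * Si (4 / √3 * z.1 * ((-z.1 + z.2 * √3) / 2)) +
        2 / Real.pi * Si (4 / √3 * z.1 * ((-z.1 - z.2 * √3) / 2)) +
        2 / Real.pi * Si (4 / √3 * ((-z.1 + z.2 * √3) / 2) * ((-z.1 - z.2 * √3) / 2)))
      ((1 / 2 : ℂ) • (opA ^ 2 - 3)) := by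
  refine ⟨?_, fun s t h => isWeylTransform_sgnQt h, half_smul_opA_sq_sub, isWeylTransform_opA⟩
  have h := isWeylTransform_symProd (a := 1) (b := 0) (a' := 0) (b' := 1) (by norm_num)
  simpa [sgnQ, sgnP] using h
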